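/- Let $d\in\mathbb N$, $0<n\le d$, $C_0>0$, $\alpha>1$, $\beta>\alpha^d$ and $\eta>1$, and let $\mu$ be a positive Radon measure on $\mathbb R^d$ with $\mu(Q(x,l))\le C_0l^n$ for all $x\in\mathbb R^d$ and $l>0$, where $Q(x,l)$ is the closed cube with sides parallel to the axes, centre $x$ and side length $l$. Below, a *cube* $Q$ is such a cube centred at a point of $\operatorname{supp}\mu$; $l(Q)$ is its side length, $tQ$ the concentric cube of side length $t\,l(Q)$, and $m_Qf=\mu(Q)^{-1}\int_Qf\,d\mu$. A cube $Q$ is *doubling* if $\mu(\alpha Q)\le\beta\mu(Q)$. Let $\widetilde Q=\alpha^mQ$ with $m\ge0$ the least integer for which $\alpha^mQ$ is doubling, and $Q'=\alpha^{-N}Q$ with $N\ge1$ the least integer for which $\alpha^{-N}Q$ is doubling. Put $\mathscr Q=\{Q:l(Q)\le1\}$ and $\mathscr Q_{ex}=\{Q:l(Q')\le1\}$ (if $Q'$ does not exist, which happens only for exceptional $Q$, then $Q$ is counted in $\mathscr Q_{ex}$). For $Q\subset R$ let $K_{Q,R}=1+\sum_{k=1}^{N_{Q,R}}\mu(2^kQ)\,l(2^kQ)^{-n}$,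 where $N_{Q,R}\ge0$ is the first integer $k$ with $l(2^kQ)\ge l(R)$. For real-valued $f\in L^1_{loc}(\mu)$, let $\|f\|_{RBMO(\mu)}$ be the infimum of the constants $A\ge0$ such that $\frac1{\mu(\eta Q)}\int_Q|f-m_{\widetilde Q}f|\,d\mu\le A$ for all cubes $Q$ and $|m_Qf-m_Rf|\le A\,K_{Q,R}$ for all doubling cubes $Q\subset R$. For $i=1,2,3,4$ let $\|f\|_{*i}$ be the infimum of the constants $A\ge0$ such that, respectively: * ($i=1$) $\frac1{\mu(\eta Q)}\int_Q|f-m_{\widetilde Q}f|\,d\mu\le A$ for $Q\in\mathscr Q$; $|m_Qf-m_Rf|\le A\,K_{Q,R}$ for doubling cubes $Q\subset R$ with $Q\in\mathscr Q$, $R\in\mathscr Q_{ex}$; and $\frac1{\mu(\eta Q)}\int_Q|f|\,d\mu\le A$ for $Q\in\mathscr Q_{ex}\setminus\mathscr Q$. * ($i=2$) for some family of real numbers $\{f_Q\}_Q$ indexed by the cubes: $\frac1{\mu(\eta Q)}\int_Q|f-f_Q|\,d\mu\le A$ for $Q\in\mathscr Q$; $|f_Q-f_R|\le A\,K_{Q,R}$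 for cubes $Q\subset R$ with $Q\in\mathscr Q$, $R\in\mathscr Q_{ex}$; and $|f_R|\le A$ for $R\in\mathscr Q_{ex}\setminus\mathscr Q$. * ($i=3$) $\frac1{\mu(\eta Q)}\int_Q|f-m_Qf|\,d\mu\le A$ for $Q\in\mathscr Q$; $|m_Qf-m_Rf|\le A\,K_{Q,R}\big[\frac{\mu(\eta Q)}{\mu(Q)}+\frac{\mu(\eta R)}{\mu(R)}\big]$ for cubes $Q\subset R$ with $Q\in\mathscr Q$, $R\in\mathscr Q_{ex}$; and $\frac1{\mu(\eta Q)}\int_Q|f|\,d\mu\le A$ for $Q\in\mathscr Q_{ex}\setminus\mathscr Q$. * ($i=4$) $\frac1{\mu(Q)}\int_Q|f-m_Qf|\,d\mu\le A$ for doubling $Q\in\mathscr Q$; $|m_Qf-m_Rf|\le A\,K_{Q,R}$ for doubling cubes $Q\subset R$ with $Q\in\mathscr Q$, $R\in\mathscr Q_{ex}$; and $\frac1{\mu(Q)}\int_Q|f|\,d\mu\le A$ for doubling $Q\in\mathscr Q_{ex}\setminus\mathscr Q$. The spaces $RBMO(\mu)$ and $rbmo^i_{\mathscr Q}(\mu)$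 consist of the $f\in L^1_{loc}(\mu)$ for which such a constant $A$ exists. **Proposition.** There is a constant $C>0$, depending only on $d,n,C_0,\alpha,\beta,\eta$, such that for each $i\in\{1,2,3,4\}$ (assuming $\eta\le\alpha$ if $i\ne2$): 1. $rbmo^i_{\mathscr Q}(\mu)$ with $\|\cdot\|_{*i}$ is a Banach space, functions that agree $\mu$-a.e. being identified; and its quotient by the constant functions, with the quotient norm $\inf_{c\in\mathbb R}\|f-c\|_{*i}$, is a Banach space. 2. $L^\infty(\mu)\subset rbmo^i_{\mathscr Q}(\mu)\subset RBMO(\mu)$, with $\|f\|_{*i}\le C\|f\|_{L^\infty(\mu)}$ for $f\in L^\infty(\mu)$ and $\|f\|_{RBMO(\mu)}\le C\|f\|_{*i}$ for $f\in rbmo^i_{\mathscr Q}(\mu)$. 3. If $f\in rbmo^i_{\mathscr Q}(\mu)$, then $|f|\in rbmo^i_{\mathscr Q}(\mu)$ and $\||f|\|_{*i}\le C\|f\|_{*i}$. 4. If $f,g\in rbmo^i_{\mathscr Q}(\mu)$, then $\min(f,g),\max(f,g)\in rbmo^i_{\mathscr Q}(\mu)$, and both $\|\min(f,g)\|_{*i}$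 and $\|\max(f,g)\|_{*i}$ are at most $C(\|f\|_{*i}+\|g\|_{*i})$. -/

import Mathlib

open MeasureTheory

noncomputable section

namespace LocalBMO

/-- A cube: closed, with sides parallel to the coordinate axes, of positive side length, and
centred at a point of the support of `μ` (so that it has positive measure). -/
structure Cube {d : ℕ} (μ : Measure (Fin d → ℝ)) where
  center : Fin d → ℝ
  side : ℝ
  center_mem : center ∈ μ.support
  side_pos : 0 < side

variable {d : ℕ} {μ : Measure (Fin d → ℝ)}

/-- The point set of the concentric cube `t Q`, of side length `t * l(Q)`; the distance on
`Fin d → ℝ` is the sup distance, whose closed balls are the closed axis-parallel cubes. -/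
def Cube.dil (Q : Cube μ) (t : ℝ) : Set (Fin d → ℝ) :=
  Metric.closedBall Q.center (t * Q.side / 2)

/-- The point set of `Q`. -/
def Cube.toSet (Q : Cube μ) : Set (Fin d → ℝ) :=
  Metric.closedBall Q.center (Q.side / 2)

/-- `μ (Q(x, l)) ≤ C₀ l ^ n` for every cube of `ℝ ^ d`. Such a Borel measure is finite on compact
sets, hence it is a Radon measure. -/
def Growth (μ : Measure (Fin d → ℝ)) (n C₀ : ℝ) : Prop :=
  ∀ (x : Fin d → ℝ) (l : ℝ), 0 < l → μ (Metric.closedBall x (l / 2)) ≤ ENNReal.ofReal (C₀ * l ^ n)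

/-- The mean `m_S f` of `f` over the set `S`. -/
def mean (μ : Measure (Fin d → ℝ)) (f : (Fin d → ℝ) → ℝ) (S : Set (Fin d → ℝ)) : ℝ :=
  (μ.real S)⁻¹ * ∫ x in S, f x ∂μ

/-- The concentric cube `t Q` is `(α, β)`-doubling: `μ (α t Q) ≤ β μ (t Q)`. -/
def Cube.DilDoubling (Q : Cube μ) (α β t : ℝ) : Prop :=
  μ.real (Q.dil (α * t)) ≤ β * μ.real (Q.dil t)

/-- `Q` is `(α, β)`-doubling. -/
def Cube.Doubling (Q : Cube μ) (α β : ℝ) : Prop :=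
  μ.real (Q.dil α) ≤ β * μ.real Q.toSet

/-- The point set of `Q~ = α ^ m Q`, where `m` is the smallest natural number such that
`α ^ m Q` is `(α, β)`-doubling. -/
def Cube.tilde (Q : Cube μ) (α β : ℝ) : Set (Fin d → ℝ) :=
  Q.dil (α ^ sInf {m : ℕ | Q.DilDoubling α β (α ^ m)})

/-- `Q` belongs to the family `𝒬`: `l(Q) ≤ 1`. -/
def Cube.Small (Q : Cube μ) : Prop := Q.side ≤ 1

/-- `Q` belongs to the family `𝒬_ex`: `l(Q') ≤ 1`, where `Q' = α ^ (-N) Q` is the biggest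
`(α, β)`-doubling cube among `α ^ (-1) Q, α ^ (-2) Q, …`. Such a cube exists for `μ`-almost all
centres; when none of these cubes is doubling, the condition is regarded as satisfied. -/
def Cube.SmallEx (Q : Cube μ) (α β : ℝ) : Prop :=
  ∀ N : ℕ, IsLeast {N : ℕ | 1 ≤ N ∧ Q.DilDoubling α β (α⁻¹ ^ N)} N → α⁻¹ ^ N * Q.side ≤ 1

/-- The first natural number `k` such that `l(2 ^ k Q) ≥ l(R)`. -/
def Cube.numScales (Q R : Cube μ) : ℕ := sInf {k : ℕ | R.side ≤ 2 ^ k * Q.side}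

/-- The coefficient `K_{Q,R}`. -/
def Cube.K (n : ℝ) (Q R : Cube μ) : ℝ :=
  1 + ∑ k ∈ Finset.Icc 1 (Q.numScales R), μ.real (Q.dil (2 ^ k)) / (2 ^ k * Q.side) ^ n

/-- `C` is an admissible constant for `f` in the definition of `RBMO(μ)`. -/
def BoundRBMO (μ : Measure (Fin d → ℝ)) (n η α β : ℝ) (f : (Fin d → ℝ) → ℝ) (C : ℝ) : Prop :=
  (∀ Q : Cube μ,
    (μ.real (Q.dil η))⁻¹ * ∫ x in Q.toSet, |f x - mean μ f (Q.tilde α β)| ∂μ ≤ C) ∧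
  (∀ Q R : Cube μ, Q.toSet ⊆ R.toSet → Q.Doubling α β → R.Doubling α β →
    |mean μ f Q.toSet - mean μ f R.toSet| ≤ C * Q.K n R)

/-- `C` is an admissible constant for `f` in the definition of `rbmo¹_𝒬(μ)`. -/
def Bound1 (μ : Measure (Fin d → ℝ)) (n η α β : ℝ) (f : (Fin d → ℝ) → ℝ) (C : ℝ) : Prop :=
  (∀ Q : Cube μ, Q.Small →
    (μ.real (Q.dil η))⁻¹ * ∫ x in Q.toSet, |f x - mean μ f (Q.tilde α β)| ∂μ ≤ C) ∧
  (∀ Q R : Cube μ, Q.toSet ⊆ R.toSet → Q.Doubling α β → R.Doubling α β →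
    Q.Small → R.SmallEx α β →
    |mean μ f Q.toSet - mean μ f R.toSet| ≤ C * Q.K n R) ∧
  (∀ Q : Cube μ, Q.SmallEx α β → ¬ Q.Small →
    (μ.real (Q.dil η))⁻¹ * ∫ x in Q.toSet, |f x| ∂μ ≤ C)

/-- `C` is an admissible constant for `f` in the definition of `rbmo²_𝒬(μ)`. -/
def Bound2 (μ : Measure (Fin d → ℝ)) (n η α β : ℝ) (f : (Fin d → ℝ) → ℝ) (C : ℝ) : Prop :=
  ∃ F : Cube μ → ℝ,
    (∀ Q : Cube μ, Q.Small →
      (μ.real (Q.dil η))⁻¹ * ∫ x in Q.toSet, |f x - F Q| ∂μ ≤ C) ∧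
    (∀ Q R : Cube μ, Q.toSet ⊆ R.toSet → Q.Small → R.SmallEx α β →
      |F Q - F R| ≤ C * Q.K n R) ∧
    (∀ R : Cube μ, R.SmallEx α β → ¬ R.Small → |F R| ≤ C)

/-- `C` is an admissible constant for `f` in the definition of `rbmo³_𝒬(μ)`. -/
def Bound3 (μ : Measure (Fin d → ℝ)) (n η α β : ℝ) (f : (Fin d → ℝ) → ℝ) (C : ℝ) : Prop :=
  (∀ Q : Cube μ, Q.Small →
    (μ.real (Q.dil η))⁻¹ * ∫ x in Q.toSet, |f x - mean μ f Q.toSet| ∂μ ≤ C) ∧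
  (∀ Q R : Cube μ, Q.toSet ⊆ R.toSet → Q.Small → R.SmallEx α β →
    |mean μ f Q.toSet - mean μ f R.toSet| ≤
      C * Q.K n R *
        (μ.real (Q.dil η) / μ.real Q.toSet + μ.real (R.dil η) / μ.real R.toSet)) ∧
  (∀ Q : Cube μ, Q.SmallEx α β → ¬ Q.Small →
    (μ.real (Q.dil η))⁻¹ * ∫ x in Q.toSet, |f x| ∂μ ≤ C)

/-- `C` is an admissible constant for `f` in the definition of `rbmo⁴_𝒬(μ)`. -/
def Bound4 (μ : Measure (Fin d → ℝ)) (n α β : ℝ) (f : (Fin d → ℝ) → ℝ) (C : ℝ) : Prop :=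
  (∀ Q : Cube μ, Q.Doubling α β → Q.Small →
    (μ.real Q.toSet)⁻¹ * ∫ x in Q.toSet, |f x - mean μ f Q.toSet| ∂μ ≤ C) ∧
  (∀ Q R : Cube μ, Q.toSet ⊆ R.toSet → Q.Doubling α β → R.Doubling α β →
    Q.Small → R.SmallEx α β →
    |mean μ f Q.toSet - mean μ f R.toSet| ≤ C * Q.K n R) ∧
  (∀ Q : Cube μ, Q.Doubling α β → Q.SmallEx α β → ¬ Q.Small →
    (μ.real Q.toSet)⁻¹ * ∫ x in Q.toSet, |f x| ∂μ ≤ C)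

/-- The index of the four `rbmo`-type spaces. -/
inductive Index
  | one
  | two
  | three
  | four

/-- `C` is an admissible constant for `f` in the definition of the `i`-th space. -/
def Bound (i : Index) (μ : Measure (Fin d → ℝ)) (n η α β : ℝ) (f : (Fin d → ℝ) → ℝ) (C : ℝ) :
    Prop :=
  match i with
  | .one => Bound1 μ n η α β f C
  | .two => Bound2 μ n η α β f C
  | .three => Bound3 μ n η α β f C
  | .four => Bound4 μ n α β f C

/-- `f` belongs to the `i`-th `rbmo`-type space. -/
def MemRbmo (i : Index) (μ : Measure (Fin d → ℝ)) (n η α β : ℝ) (f : (Fin d → ℝ) → ℝ) : Prop :=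
  LocallyIntegrable f μ ∧ ∃ C : ℝ, 0 ≤ C ∧ Bound i μ n η α β f C

/-- The norm of the `i`-th `rbmo`-type space. -/
def normRbmo (i : Index) (μ : Measure (Fin d → ℝ)) (n η α β : ℝ) (f : (Fin d → ℝ) → ℝ) : ℝ :=
  sInf {C : ℝ | 0 ≤ C ∧ Bound i μ n η α β f C}

/-- The quotient norm of the class of `f` modulo additive constants. -/
def quotNormRbmo (i : Index) (μ : Measure (Fin d → ℝ)) (n η α β : ℝ) (f : (Fin d → ℝ) → ℝ) : ℝ :=
  ⨅ c : ℝ, normRbmo i μ n η α β (fun x => f x - c)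

/-- `f` belongs to `RBMO(μ)`. -/
def MemRBMO (μ : Measure (Fin d → ℝ)) (n η α β : ℝ) (f : (Fin d → ℝ) → ℝ) : Prop :=
  LocallyIntegrable f μ ∧ ∃ C : ℝ, 0 ≤ C ∧ BoundRBMO μ n η α β f C

/-- The norm of `RBMO(μ)`. -/
def normRBMO (μ : Measure (Fin d → ℝ)) (n η α β : ℝ) (f : (Fin d → ℝ) → ℝ) : ℝ :=
  sInf {C : ℝ | 0 ≤ C ∧ BoundRBMO μ n η α β f C}

/-- The functions satisfying `mem` form a real vector space which, modulo the functions satisfying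
`null`, is a Banach space whose norm is given by `nrm`. The Banach space is `X`, and `T` sends a
function to its class. -/
def IsBanachModulo (mem : ((Fin d → ℝ) → ℝ) → Prop) (nrm : ((Fin d → ℝ) → ℝ) → ℝ)
    (null : ((Fin d → ℝ) → ℝ) → Prop) : Prop :=
  ∃ V : Submodule ℝ ((Fin d → ℝ) → ℝ), (∀ f, f ∈ V ↔ mem f) ∧
    ∃ (X : Type) (_ : NormedAddCommGroup X) (_ : NormedSpace ℝ X) (_ : CompleteSpace X)
      (T : V →ₗ[ℝ] X), Function.Surjective T ∧ (∀ f : V, ‖T f‖ = nrm f) ∧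
        ∀ f : V, T f = 0 ↔ null f

end LocalBMO

end

noncomputable section

namespace LocalBMO

variable {d : ℕ} {μ : Measure (Fin d → ℝ)}

/-! ### Growth and densities -/

/-! Everything rests on two facts about scales. First, sums of densities μ(Q(x,u)) u^(-n) over
dyadic u in a range (lo, hi] are bounded when hi/lo is bounded, by the growth condition, and also
along a chain of consecutive non-doubling cubes, where the densities decay geometrically
(`exists_dyadicSumLE_chain`). `DyadicSumLE` records such bounds uniformly in the starting scale, so
that they can be concatenated, re-centred, and turned into bounds for K_{Q,R}. Second, doubling
cubes abound: above every scale at each point of the support (`exists_dbl_up`), and, because β >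
α^d, below every scale at almost every point (`ae_exists_dbl_down`).

Up to constants the fourth condition is the weakest of the four (`exists_bound4_of_bound`), yet it
gives back a lot. The mean over a small doubling cube is compared with that over a concentric
doubling cube of 𝒬_ex ∖ 𝒬, where the average of |f| is bounded. A Besicovitch covering of an
arbitrary cube Q by small doubling cubes inside ρQ then gives estimates with μ(ρQ) on the right, for
any ρ > 1 (`exists_integral_le_of_bound4`, `exists_oscillation_le_of_bound4`). This yields the
embedding into RBMO. For the second space the same covering, with cubes doubling relative to η,
makes η ≤ α unnecessary.

Absolute values are handled by ||f| - |c|| ≤ |f - c|: the numbers |f_Q| serve for |f|, and m_Q|f| is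
close to |m_Q f|. Minima and maxima are (f + g ∓ |f - g|)/2.

For completeness, every condition is countably subadditive in f (`LocSum.bound`), and a zero or
summable norm passes to L¹ of every ball (`exists_lintegral_closedBall_le`). Hence an absolutely
convergent series converges almost everywhere, its sum lies in the space, and its tails tend to zero
in norm. Completeness of the quotient by constants follows on choosing near-optimal constants. -/

theorem Growth.isLocallyFiniteMeasure {n C₀ : ℝ} (hg : Growth μ n C₀) :
    IsLocallyFiniteMeasure μ := by
  refine ⟨fun x => ⟨Metric.closedBall x (1 / 2), Metric.closedBall_mem_nhds x (by norm_num), ?_⟩⟩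
  exact (hg x 1 one_pos).trans_lt ENNReal.ofReal_lt_top

theorem measureReal_closedBall_mono [IsLocallyFiniteMeasure μ] {x y : Fin d → ℝ} {r s : ℝ}
    (h : Metric.closedBall x r ⊆ Metric.closedBall y s) :
    μ.real (Metric.closedBall x r) ≤ μ.real (Metric.closedBall y s) :=
  measureReal_mono h measure_closedBall_lt_top.ne

theorem measureReal_closedBall_pos [IsLocallyFiniteMeasure μ] {x : Fin d → ℝ} {r : ℝ}
    (hx : x ∈ μ.support) (hr : 0 < r) : 0 < μ.real (Metric.closedBall x r) :=
  ENNReal.toReal_pos (Measure.mem_support_iff_forall x |>.1 hx _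
    (Metric.closedBall_mem_nhds x hr)).ne' measure_closedBall_lt_top.ne

/-- The `n`-dimensional density of `μ` on the cube of centre `x` and side length `u`. -/
def dens (μ : Measure (Fin d → ℝ)) (n : ℝ) (x : Fin d → ℝ) (u : ℝ) : ℝ :=
  μ.real (Metric.closedBall x (u / 2)) / u ^ n

theorem dens_nonneg (n : ℝ) (x : Fin d → ℝ) {u : ℝ} (hu : 0 < u) : 0 ≤ dens μ n x u := by
  unfold dens; positivity

theorem Growth.measureReal_le {n C₀ : ℝ} (hg : Growth μ n C₀) (hC₀ : 0 < C₀) (x : Fin d → ℝ)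
    {u : ℝ} (hu : 0 < u) : μ.real (Metric.closedBall x (u / 2)) ≤ C₀ * u ^ n :=
  ENNReal.toReal_le_of_le_ofReal (by positivity) (hg x u hu)

theorem Growth.dens_le {n C₀ : ℝ} (hg : Growth μ n C₀) (hC₀ : 0 < C₀) (x : Fin d → ℝ)
    {u : ℝ} (hu : 0 < u) : dens μ n x u ≤ C₀ := by
  unfold dens
  rw [div_le_iff₀ (by positivity)]
  exact hg.measureReal_le hC₀ x hu

/-- Enlarging the cube can only increase its mass, while the normalising power of the side grows by
at most a^n. -/
theorem dens_le_of_le [IsLocallyFiniteMeasure μ] {n : ℝ} (hn : 0 < n) {x y : Fin d → ℝ}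
    {u v a : ℝ} (hu : 0 < u) (hv : v ≤ a * u)
    (h : Metric.closedBall x (u / 2) ⊆ Metric.closedBall y (v / 2)) (hv0 : 0 < v) :
    dens μ n x u ≤ a ^ n * dens μ n y v := by
  have ha : 0 < a := pos_of_mul_pos_left (hv0.trans_le hv) hu.le
  unfold dens
  rw [div_le_iff₀ (by positivity), mul_div_assoc', div_mul_eq_mul_div, le_div_iff₀ (by positivity)]
  have h1 : v ^ n ≤ a ^ n * u ^ n := by
    rw [← Real.mul_rpow ha.le hu.le]; exact Real.rpow_le_rpow hv0.le hv hn.le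
  have h2 := measureReal_closedBall_mono (μ := μ) h
  have h3 : (0 : ℝ) ≤ μ.real (Metric.closedBall y (v / 2)) := measureReal_nonneg
  calc _ ≤ μ.real (Metric.closedBall y (v / 2)) * (a ^ n * u ^ n) := by
        apply mul_le_mul h2 h1 (by positivity) h3
    _ = _ := by ring

/-! ### Dyadic sums of densities -/

/-- Every sum of densities over dyadic side lengths in `(lo, hi]` is at most `M`. -/
def DyadicSumLE (μ : Measure (Fin d → ℝ)) (n : ℝ) (x : Fin d → ℝ) (lo hi M : ℝ) : Prop :=
  ∀ s : ℝ, 0 < s → ∀ N : ℕ,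
    ∑ k ∈ (Finset.Icc 1 N).filter (fun k => lo < 2 ^ k * s ∧ 2 ^ k * s ≤ hi),
      dens μ n x (2 ^ k * s) ≤ M

theorem DyadicSumLE.mono {n : ℝ} {x : Fin d → ℝ} {lo hi M M' : ℝ} (h : DyadicSumLE μ n x lo hi M)
    (hM : M ≤ M') : DyadicSumLE μ n x lo hi M' := fun s hs N => (h s hs N).trans hM

theorem DyadicSumLE.subset {n : ℝ} {x : Fin d → ℝ} {lo hi lo' hi' M : ℝ}
    (h : DyadicSumLE μ n x lo hi M) (h1 : lo ≤ lo') (h2 : hi' ≤ hi) :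
    DyadicSumLE μ n x lo' hi' M := by
  intro s hs N
  refine le_trans (Finset.sum_le_sum_of_subset_of_nonneg ?_ ?_) (h s hs N)
  · intro k; simp only [Finset.mem_filter]
    rintro ⟨h3, h4, h5⟩
    exact ⟨h3, by linarith, by linarith⟩
  · intro k _ _; exact dens_nonneg _ _ (by positivity)

/-- The terms split at `mid`. Uniformity in the starting scale spares any alignment of the two
ranges, and no ordering of `lo`, `mid`, `hi` is required, so one of the ranges may be empty. -/
theorem DyadicSumLE.trans {n : ℝ} {x : Fin d → ℝ} {lo mid hi M M' : ℝ}
    (h : DyadicSumLE μ n x lo mid M) (h' : DyadicSumLE μ n x mid hi M') :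
    DyadicSumLE μ n x lo hi (M + M') := by
  intro s hs N
  refine le_trans ?_ (add_le_add (h s hs N) (h' s hs N))
  refine le_trans (Finset.sum_le_sum_of_subset_of_nonneg (t :=
    (Finset.Icc 1 N).filter (fun k => lo < 2 ^ k * s ∧ 2 ^ k * s ≤ mid) ∪
    (Finset.Icc 1 N).filter (fun k => mid < 2 ^ k * s ∧ 2 ^ k * s ≤ hi)) ?_ ?_) ?_
  · intro k; simp only [Finset.mem_filter, Finset.mem_union]
    rintro ⟨h3, h4, h5⟩
    rcases le_or_gt (2 ^ k * s) mid with h6 | h6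
    · exact Or.inl ⟨h3, h4, h6⟩
    · exact Or.inr ⟨h3, h6, h5⟩
  · intro k _ _; exact dens_nonneg _ _ (by positivity)
  · rw [← Finset.sum_union_inter]
    exact le_add_of_nonneg_right (Finset.sum_nonneg fun k _ => dens_nonneg _ _ (by positivity))

/-- For u > lo the cube of side u about y lies in the cube of side 2u about x; doubling the side
costs the factor 2^n. -/
theorem DyadicSumLE.shift [IsLocallyFiniteMeasure μ] {n : ℝ} (hn : 0 < n) {x y : Fin d → ℝ}
    {lo hi M : ℝ} (h : DyadicSumLE μ n x (2 * lo) (2 * hi) M) (hxy : dist y x ≤ lo / 2) :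
    DyadicSumLE μ n y lo hi (2 ^ n * M) := by
  intro s hs N
  refine le_trans ?_ (mul_le_mul_of_nonneg_left (h (2 * s) (by positivity) N) (by positivity))
  rw [Finset.mul_sum]
  have : (Finset.Icc 1 N).filter (fun k => lo < 2 ^ k * s ∧ 2 ^ k * s ≤ hi) =
      (Finset.Icc 1 N).filter (fun k => 2 * lo < 2 ^ k * (2 * s) ∧ 2 ^ k * (2 * s) ≤ 2 * hi) := by
    apply Finset.filter_congr
    intro k _
    constructor <;> rintro ⟨h1, h2⟩ <;> constructor <;> linarith
  rw [← this]
  apply Finset.sum_le_sum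
  intro k hk
  have hk := (Finset.mem_filter.1 hk).2
  have h0 : 0 < 2 ^ k * s := by positivity
  refine dens_le_of_le hn h0 (le_of_eq (by ring)) ?_ (by positivity)
  refine Metric.closedBall_subset_closedBall' ?_
  linarith [hk.1]

/-- At most P terms of a dyadic progression fit into (lo, 2^P lo]. -/
theorem dyadicSumLE_of_dens_le {n : ℝ} {x : Fin d → ℝ} {lo hi D : ℝ} {P : ℕ} (hD : 0 ≤ D)
    (hP : hi ≤ 2 ^ P * lo) (h : ∀ u, lo < u → u ≤ hi → dens μ n x u ≤ D) :
    DyadicSumLE μ n x lo hi (P * D) := by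
  intro s hs N
  set F := (Finset.Icc 1 N).filter (fun k => lo < 2 ^ k * s ∧ 2 ^ k * s ≤ hi) with hF
  have hcard : F.card ≤ P := by
    rcases F.eq_empty_or_nonempty with h0 | h0
    · simp [h0]
    · have hsub : F ⊆ Finset.Ico (F.min' h0) (F.min' h0 + P) := by
        intro k hk
        rw [Finset.mem_Ico]
        refine ⟨Finset.min'_le _ _ hk, ?_⟩
        have h1 := (Finset.mem_filter.1 hk).2.2
        have h2 := (Finset.mem_filter.1 (Finset.min'_mem F h0)).2.1
        by_contra hc
        have h3 : (2 : ℝ) ^ (F.min' h0 + P) ≤ 2 ^ k :=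
          pow_le_pow_right₀ (by norm_num) (not_lt.1 hc)
        rw [pow_add] at h3
        have h4 : (2 : ℝ) ^ P * lo < 2 ^ P * (2 ^ (F.min' h0) * s) := by gcongr
        have h5 : (2 : ℝ) ^ F.min' h0 * 2 ^ P * s ≤ 2 ^ k * s := by gcongr
        linarith
      simpa using Finset.card_le_card hsub
  calc ∑ k ∈ F, dens μ n x (2 ^ k * s) ≤ ∑ k ∈ F, D :=
        Finset.sum_le_sum fun k hk => h _ (Finset.mem_filter.1 hk).2.1 (Finset.mem_filter.1 hk).2.2
    _ = F.card * D := by simp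
    _ ≤ P * D := by gcongr

/-- Comparable scales contribute a bounded amount by growth alone. This bridges the gaps between
chains of non-doubling cubes. -/
theorem exists_dyadicSumLE_ratio (n C₀ : ℝ) (hC₀ : 0 < C₀) (c : ℝ) :
    ∃ M : ℝ, 0 ≤ M ∧ ∀ {d : ℕ} (μ : Measure (Fin d → ℝ)), Growth μ n C₀ →
      ∀ (x : Fin d → ℝ) (lo hi : ℝ), 0 < lo → hi ≤ c * lo → DyadicSumLE μ n x lo hi M := by
  obtain ⟨P, hP⟩ := pow_unbounded_of_one_lt c (by norm_num : (1 : ℝ) < 2)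
  refine ⟨P * C₀, by positivity, fun μ hg x lo hi hlo hhi => ?_⟩
  exact dyadicSumLE_of_dens_le hC₀.le (hhi.trans (by gcongr))
    fun u hu _ => hg.dens_le hC₀ x (hlo.trans hu)

/-- The cube of centre `x` and side length `s` is `(a, b)`-doubling. -/
def Dbl (μ : Measure (Fin d → ℝ)) (a b : ℝ) (x : Fin d → ℝ) (s : ℝ) : Prop :=
  μ.real (Metric.closedBall x (a * s / 2)) ≤ b * μ.real (Metric.closedBall x (s / 2))

/-- Along a chain of non-doubling cubes the densities decay geometrically. -/
theorem exists_dyadicSumLE_chain (n C₀ a b : ℝ) (hn : 0 < n) (hC₀ : 0 < C₀) (ha : 1 < a)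
    (hab : a ^ n < b) :
    ∃ M : ℝ, 0 ≤ M ∧ ∀ {d : ℕ} (μ : Measure (Fin d → ℝ)), Growth μ n C₀ →
      ∀ (x : Fin d → ℝ) (s : ℝ) (m : ℕ), 0 < s →
        (∀ j, 0 < j → j < m → ¬ Dbl μ a b x (a ^ j * s)) → DyadicSumLE μ n x s (a ^ m * s) M := by
  obtain ⟨P, hP⟩ := pow_unbounded_of_one_lt a (by norm_num : (1 : ℝ) < 2)
  have ha0 : 0 < a := by linarith
  have han : 0 < a ^ n := by positivity
  have hb : 0 < b := han.trans hab
  set q : ℝ := a ^ n / b with hq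
  have hq0 : 0 < q := by positivity
  have hq1 : q < 1 := (div_lt_one hb).2 hab
  refine ⟨P * (a ^ n * C₀) * (1 - q)⁻¹, by
    have : 0 < 1 - q := by linarith
    positivity, fun {d} μ hg x s m hs hnd => ?_⟩
  have := hg.isLocallyFiniteMeasure
  -- Counted from the top of the chain: failure of doubling at scale v gives b μ(v) < μ(a v), so the
  -- density at v is at most q = a^n / b times that at a v.
  have hdecay : ∀ i, i < m → dens μ n x (a ^ (m - i) * s) ≤ C₀ * q ^ i := by
    intro i
    induction i with
    | zero => intro _; simpa using hg.dens_le hC₀ x (by positivity)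
    | succ i ih =>
      intro hi
      have h1 := ih (by omega)
      have h2 := hnd (m - (i + 1)) (by omega) (by omega)
      have h3 : m - i = (m - (i + 1)) + 1 := by omega
      rw [h3] at h1
      unfold Dbl at h2
      rw [not_le] at h2
      set v := a ^ (m - (i + 1)) * s with hv
      have hv0 : 0 < v := by positivity
      have h4 : a ^ (m - (i + 1) + 1) * s = a * v := by rw [hv]; ring
      rw [h4] at h1
      have h5 : b * dens μ n x v ≤ a ^ n * dens μ n x (a * v) := by
        unfold dens
        rw [Real.mul_rpow ha0.le hv0.le]
        rw [mul_div_assoc', mul_div_assoc', mul_div_mul_left _ _ han.ne']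
        gcongr
      calc dens μ n x v ≤ a ^ n * dens μ n x (a * v) / b := by
            rw [le_div_iff₀ hb]; linarith
        _ ≤ a ^ n * (C₀ * q ^ i) / b := by gcongr
        _ = C₀ * q ^ (i + 1) := by rw [hq]; ring
  -- Each factor-a range of scales holds at most P dyadic ones, with density at most a^n times that
  -- of its upper end. The lowest range ends at a s, so nothing is needed at s itself.
  have key : ∀ i, i ≤ m → DyadicSumLE μ n x (a ^ (m - i) * s) (a ^ m * s)
      (P * (a ^ n * C₀) * ∑ j ∈ Finset.range i, q ^ j) := by
    intro i
    induction i with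
    | zero =>
      intro _ t ht N
      rw [Finset.filter_false_of_mem]
      · simp
      · intro k _; simp
    | succ i ih =>
      intro hi
      rw [Finset.sum_range_succ_comm, mul_add]
      refine DyadicSumLE.trans (mid := a ^ (m - i) * s) ?_ (ih (by omega))
      have h3 : a ^ (m - i) * s = a * (a ^ (m - (i + 1)) * s) := by
        have : m - i = (m - (i + 1)) + 1 := by omega
        rw [this]; ring
      have h4 : (P : ℝ) * (a ^ n * C₀) * q ^ i = P * (a ^ n * (C₀ * q ^ i)) := by ring
      rw [h4]
      refine dyadicSumLE_of_dens_le (by positivity) ?_ ?_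
      · rw [h3]; gcongr
      · intro u hu hu'
        have hu0 : 0 < u := lt_trans (by positivity) hu
        refine (dens_le_of_le hn hu0 (v := a ^ (m - i) * s) (a := a) ?_
          (Metric.closedBall_subset_closedBall (by linarith)) (by positivity)).trans ?_
        · rw [h3]; gcongr
        · have := hdecay i (by omega)
          gcongr
  have := key m le_rfl
  simp only [Nat.sub_self, pow_zero, one_mul] at this
  refine this.mono ?_
  gcongr
  have h1 : 0 < 1 - q := by linarith
  have h2 := geom_sum_eq hq1.ne m
  rw [h2, ← neg_div_neg_eq, neg_sub, neg_sub, div_le_iff₀ h1, inv_mul_cancel₀ h1.ne']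
  have : 0 ≤ q ^ m := by positivity
  linarith

/-! ### The coefficients `K_{Q,R}` -/

theorem K_eq (n : ℝ) (Q R : Cube μ) :
    Q.K n R = 1 + ∑ k ∈ Finset.Icc 1 (Q.numScales R), dens μ n Q.center (2 ^ k * Q.side) := rfl

theorem one_le_K (n : ℝ) (Q R : Cube μ) : 1 ≤ Q.K n R := by
  rw [K_eq]
  have := Q.side_pos
  exact le_add_of_nonneg_right (Finset.sum_nonneg fun k _ => dens_nonneg _ _ (by positivity))

theorem lt_side_of_lt_numScales {Q R : Cube μ} {k : ℕ} (hk : k < Q.numScales R) :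
    2 ^ k * Q.side < R.side :=
  not_le.1 (Nat.notMem_of_lt_sInf hk)

theorem side_le_numScales (Q R : Cube μ) : R.side ≤ 2 ^ (Q.numScales R) * Q.side := by
  have hne : {k : ℕ | R.side ≤ 2 ^ k * Q.side}.Nonempty := by
    obtain ⟨k, hk⟩ := pow_unbounded_of_one_lt (R.side / Q.side) (by norm_num : (1 : ℝ) < 2)
    exact ⟨k, ((div_lt_iff₀ Q.side_pos).1 hk).le⟩
  exact Nat.sInf_mem hne

/-- The last scale in K_{Q,R} may overshoot l(R), but the preceding one is below it; hence the upper
limit 2 l(R). -/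
theorem K_le_of_dyadicSumLE {n M : ℝ} {Q R : Cube μ}
    (h : DyadicSumLE μ n Q.center Q.side (2 * R.side) M) : Q.K n R ≤ 1 + M := by
  rw [K_eq]
  gcongr
  refine le_trans (le_of_eq ?_) (h Q.side Q.side_pos (Q.numScales R))
  rw [Finset.filter_true_of_mem]
  intro k hk
  rw [Finset.mem_Icc] at hk
  have hs := Q.side_pos
  constructor
  · have : (1 : ℝ) < 2 ^ k := one_lt_pow₀ (by norm_num) (by omega)
    nlinarith
  · have h1 := lt_side_of_lt_numScales (Q := Q) (R := R) (k := k - 1) (by omega)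
    have h2 : (2 : ℝ) ^ k = 2 * 2 ^ (k - 1) := by rw [← pow_succ']; congr 1; omega
    rw [h2]; linarith

/-- The scales of Q up to t < l(R) already occur in K_{Q,R}; only those in (t, 2 l(T)] are new. No
relation between R and T is used, so a large cube can be traded for one in 𝒬_ex. -/
theorem K_le_K_add {n M : ℝ} {Q R T : Cube μ} {t : ℝ} (ht : t < R.side)
    (hc : DyadicSumLE μ n Q.center t (2 * T.side) M) : Q.K n T ≤ Q.K n R + M := by
  have hs := Q.side_pos
  rw [K_eq, K_eq, add_assoc]
  gcongr
  refine le_trans ?_ (add_le_add le_rfl (hc Q.side hs (Q.numScales T)))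
  refine le_trans (Finset.sum_le_sum_of_subset_of_nonneg (t := Finset.Icc 1 (Q.numScales R) ∪
    (Finset.Icc 1 (Q.numScales T)).filter
      (fun k => t < 2 ^ k * Q.side ∧ 2 ^ k * Q.side ≤ 2 * T.side)) ?_ ?_) ?_
  · intro k hk
    rw [Finset.mem_union, Finset.mem_filter]
    have hk' := Finset.mem_Icc.1 hk
    rcases le_or_gt (2 ^ k * Q.side) t with h6 | h6
    · left
      rw [Finset.mem_Icc]
      refine ⟨hk'.1, ?_⟩
      by_contra hcon
      have h7 := side_le_numScales Q R
      have h8 : (2 : ℝ) ^ (Q.numScales R) * Q.side ≤ 2 ^ k * Q.side := by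
        gcongr
        · norm_num
        · omega
      linarith
    · right
      refine ⟨hk, h6, ?_⟩
      have h1 := lt_side_of_lt_numScales (Q := Q) (R := T) (k := k - 1) (by omega)
      have h2 : (2 : ℝ) ^ k = 2 * 2 ^ (k - 1) := by rw [← pow_succ']; congr 1; omega
      rw [h2]; linarith
  · intro k _ _; exact dens_nonneg _ _ (by positivity)
  · rw [← Finset.sum_union_inter]
    exact le_add_of_nonneg_right (Finset.sum_nonneg fun k _ => dens_nonneg _ _ (by positivity))

/-! ### Existence of doubling cubes -/

/-- If no dilate were doubling, the masses would grow at least like b^m, against the growth bound of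
order (a^n)^m. -/
theorem exists_dbl_up {n C₀ a b : ℝ} (hg : Growth μ n C₀) (hC₀ : 0 < C₀) (ha : 1 < a)
    (hab : a ^ n < b) {x : Fin d → ℝ} (hx : x ∈ μ.support) {s : ℝ} (hs : 0 < s) :
    ∃ m : ℕ, Dbl μ a b x (a ^ m * s) := by
  have := hg.isLocallyFiniteMeasure
  by_contra! hcon
  have ha0 : 0 < a := by linarith
  have han : 0 < a ^ n := by positivity
  have hb : 0 < b := han.trans hab
  have hpos : 0 < μ.real (Metric.closedBall x (s / 2)) :=
    measureReal_closedBall_pos hx (by positivity)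
  have h1 : ∀ m : ℕ, b ^ m * μ.real (Metric.closedBall x (s / 2)) ≤
      μ.real (Metric.closedBall x (a ^ m * s / 2)) := by
    intro m
    induction m with
    | zero => simp
    | succ m ih =>
      have h2 := hcon m
      unfold Dbl at h2
      rw [not_le] at h2
      have h3 : a ^ (m + 1) * s / 2 = a * (a ^ m * s) / 2 := by ring
      rw [h3]
      calc _ = b * (b ^ m * μ.real (Metric.closedBall x (s / 2))) := by ring
        _ ≤ _ := by gcongr
        _ ≤ _ := h2.le
  have hr : 1 < b / a ^ n := (one_lt_div han).2 hab
  obtain ⟨m, hm⟩ := pow_unbounded_of_one_lt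
    (C₀ * s ^ n / μ.real (Metric.closedBall x (s / 2))) hr
  rw [div_lt_iff₀ hpos, div_pow, div_mul_eq_mul_div, lt_div_iff₀ (by positivity)] at hm
  have h4 := (h1 m).trans (hg.measureReal_le hC₀ x (u := a ^ m * s) (by positivity))
  rw [Real.mul_rpow (by positivity) hs.le, ← Real.rpow_natCast a, ← Real.rpow_mul ha0.le,
    mul_comm (m : ℝ) n, Real.rpow_mul ha0.le, Real.rpow_natCast] at h4
  linarith [mul_assoc C₀ (s ^ n) ((a ^ n) ^ m), mul_assoc C₀ ((a ^ n) ^ m) (s ^ n),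
    mul_comm (s ^ n) ((a ^ n) ^ m)]

/-- By Besicovitch differentiation the density of Lebesgue measure with respect to μ is finite
μ-almost everywhere, so s^d ≤ M μ(Q(x,s)) for small s. Were no smaller cube doubling, the masses
would decay at least like b^(-m), faster than (a^d)^(-m). This is where b > a^d is needed instead of
b > a^n. -/
theorem ae_exists_dbl_down [IsLocallyFiniteMeasure μ] {a b : ℝ} (ha : 1 < a) (hab : a ^ d < b) :
    ∀ᵐ x ∂μ, ∀ s : ℝ, 0 < s → ∃ m : ℕ, Dbl μ a b x (s / a ^ m) := by
  filter_upwards [Besicovitch.ae_tendsto_rnDeriv (volume : Measure (Fin d → ℝ)) μ,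
    Measure.rnDeriv_lt_top (volume : Measure (Fin d → ℝ)) μ, Measure.support_mem_ae (μ := μ)]
    with x hx hlt hsupp s hs
  by_contra! hcon
  have ha0 : 0 < a := by linarith
  have hb : 0 < b := lt_trans (by positivity) hab
  obtain ⟨M, hM1, hM2⟩ := ENNReal.lt_iff_exists_nnreal_btwn.1 hlt
  have hev := hx.eventually (gt_mem_nhds hM1)
  have h1 : ∀ m : ℕ, b ^ m * μ.real (Metric.closedBall x (s / a ^ m / 2)) ≤
      μ.real (Metric.closedBall x (s / 2)) := by
    intro m
    induction m with
    | zero => simp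
    | succ m ih =>
      have h2 := hcon (m + 1)
      unfold Dbl at h2
      rw [not_le] at h2
      have h3 : a * (s / a ^ (m + 1)) / 2 = s / a ^ m / 2 := by rw [pow_succ]; field_simp
      rw [h3] at h2
      calc _ = b ^ m * (b * μ.real (Metric.closedBall x (s / a ^ (m + 1) / 2))) := by ring
        _ ≤ b ^ m * μ.real (Metric.closedBall x (s / a ^ m / 2)) := by gcongr
        _ ≤ _ := ih
  have htend : Filter.Tendsto (fun m : ℕ => s / a ^ m / 2) Filter.atTop
      (nhdsWithin 0 (Set.Ioi 0)) := by
    rw [tendsto_nhdsWithin_iff]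
    refine ⟨?_, Filter.Eventually.of_forall fun m => by simp only [Set.mem_Ioi]; positivity⟩
    have h2 : Filter.Tendsto (fun m : ℕ => s / 2 * (a⁻¹) ^ m) Filter.atTop (nhds (s / 2 * 0)) :=
      (tendsto_pow_atTop_nhds_zero_of_lt_one (by positivity) (inv_lt_one_of_one_lt₀ ha)).const_mul _
    rw [mul_zero] at h2
    refine h2.congr fun m => ?_
    rw [inv_pow]; ring
  have hvol : ∀ᶠ m : ℕ in Filter.atTop,
      (s / a ^ m) ^ d ≤ M * μ.real (Metric.closedBall x (s / a ^ m / 2)) := by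
    filter_upwards [htend.eventually hev] with m hm
    have hm0 : 0 < s / a ^ m / 2 := by positivity
    have hpos := measureReal_closedBall_pos hsupp hm0
    have hμ0 : μ (Metric.closedBall x (s / a ^ m / 2)) ≠ 0 :=
      (Measure.mem_support_iff_forall x |>.1 hsupp _ (Metric.closedBall_mem_nhds x hm0)).ne'
    have h5 := (ENNReal.div_le_iff hμ0 measure_closedBall_lt_top.ne).1 hm.le
    rw [Real.volume_pi_closedBall x hm0.le, Fintype.card_fin] at h5
    have h6 := ENNReal.toReal_mono (ENNReal.mul_ne_top ENNReal.coe_ne_top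
      measure_closedBall_lt_top.ne) h5
    rw [ENNReal.toReal_ofReal (by positivity), ENNReal.toReal_mul] at h6
    have h7 : 2 * (s / a ^ m / 2) = s / a ^ m := by ring
    rw [h7] at h6
    exact h6
  have hr : 1 < b / a ^ d := (one_lt_div (by positivity)).2 hab
  have hev2 := (tendsto_pow_atTop_atTop_of_one_lt hr).eventually_gt_atTop
    (M * μ.real (Metric.closedBall x (s / 2)) / s ^ d)
  obtain ⟨m, hm1, hm2⟩ := (hvol.and hev2).exists
  rw [div_pow b, div_lt_div_iff₀ (by positivity) (by positivity)] at hm2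
  rw [div_pow, div_le_iff₀ (by positivity)] at hm1
  have h8 := h1 m
  have h9 : b ^ m * s ^ d ≤ M * μ.real (Metric.closedBall x (s / 2)) * (a ^ d) ^ m := by
    calc b ^ m * s ^ d ≤ b ^ m * (M * μ.real (Metric.closedBall x (s / a ^ m / 2)) * (a ^ m) ^ d) := by
          gcongr
      _ = M * (b ^ m * μ.real (Metric.closedBall x (s / a ^ m / 2))) * (a ^ d) ^ m := by ring
      _ ≤ _ := by gcongr
  linarith

/-- Above every scale `t` there is a doubling cube, with no mass accumulation in between; it
belongs to `𝒬_ex` if `t ≤ 1`. -/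
theorem exists_doubling_above (n C₀ a b : ℝ) (hn : 0 < n) (hC₀ : 0 < C₀) (ha : 1 < a)
    (hab : a ^ n < b) :
    ∃ M : ℝ, 0 ≤ M ∧ ∀ {d : ℕ} (μ : Measure (Fin d → ℝ)), Growth μ n C₀ →
      ∀ (x : Fin d → ℝ) (hx : x ∈ μ.support) (t : ℝ), 0 < t →
        ∃ (T : ℝ) (hT : 0 < T), t < T ∧ DyadicSumLE μ n x t T M ∧
          (⟨x, T, hx, hT⟩ : Cube μ).Doubling a b ∧
          (t ≤ 1 → (⟨x, T, hx, hT⟩ : Cube μ).SmallEx a b) := by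
  obtain ⟨M, hM0, hM⟩ := exists_dyadicSumLE_chain n C₀ a b hn hC₀ ha hab
  refine ⟨M, hM0, fun μ hg x hx t ht => ?_⟩
  classical
  have ha0 : 0 < a := by linarith
  -- The search starts at a t, so that the side found exceeds t strictly; with t = 1 the cube is
  -- then outside 𝒬.
  have hex := exists_dbl_up hg hC₀ ha hab hx (s := a * t) (by positivity)
  set m := Nat.find hex with hm
  have hmd : Dbl μ a b x (a ^ m * (a * t)) := Nat.find_spec hex
  have heq : a ^ m * (a * t) = a ^ (m + 1) * t := by ring
  refine ⟨a ^ (m + 1) * t, by positivity, ?_, ?_, ?_, ?_⟩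
  · have : 1 < a ^ (m + 1) := one_lt_pow₀ ha (by omega)
    nlinarith
  · refine hM μ hg x t (m + 1) ht fun j hj hjm => ?_
    have h1 := Nat.find_min hex (m := j - 1) (by omega)
    have h2 : a ^ (j - 1) * (a * t) = a ^ j * t := by
      rw [← mul_assoc, ← pow_succ]; congr 2; omega
    rwa [h2] at h1
  · rw [heq] at hmd; exact hmd
  -- By minimality no cube of the chain strictly between the scale t and the one found is doubling,
  -- so the next doubling cube below has side at most t ≤ 1.
  · intro ht1 N hN
    obtain ⟨hN1, hN2⟩ := hN.1
    simp only
    have hinv : ∀ k : ℕ, k ≤ m + 1 → a⁻¹ ^ k * (a ^ (m + 1) * t) = a ^ (m + 1 - k) * t := by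
      intro k hk
      rw [← mul_assoc, inv_pow]
      congr 1
      rw [inv_mul_eq_iff_eq_mul₀ (by positivity), ← pow_add]
      congr 1; omega
    rcases le_or_gt (m + 1) N with h | h
    · calc a⁻¹ ^ N * (a ^ (m + 1) * t) ≤ a⁻¹ ^ (m + 1) * (a ^ (m + 1) * t) := by
            gcongr ?_ * _
            exact pow_le_pow_of_le_one (by positivity) (inv_le_one_of_one_le₀ ha.le) h
        _ = t := by rw [hinv _ le_rfl]; simp
        _ ≤ 1 := ht1
    · exfalso
      refine Nat.find_min hex (m := m - N) (by omega) ?_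
      have h3 : a ^ (m - N) * (a * t) = a⁻¹ ^ N * (a ^ (m + 1) * t) := by
        rw [hinv N h.le, ← mul_assoc, ← pow_succ]; congr 2; omega
      rw [h3]
      unfold Cube.DilDoubling Cube.dil at hN2
      unfold Dbl
      rw [← mul_assoc]
      exact hN2

/-- Almost every point is the centre of a doubling cube below every scale `t`, with no mass
accumulation in between. -/
theorem exists_doubling_below (n C₀ a b : ℝ) (hn : 0 < n) (hC₀ : 0 < C₀) (ha : 1 < a)
    (hab : a ^ n < b) :
    ∃ M : ℝ, 0 ≤ M ∧ ∀ {d : ℕ} (μ : Measure (Fin d → ℝ)), Growth μ n C₀ → a ^ d < b →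
      ∀ᵐ x ∂μ, ∀ t : ℝ, 0 < t →
        ∃ s : ℝ, 0 < s ∧ s ≤ t ∧ DyadicSumLE μ n x s t M ∧ Dbl μ a b x s := by
  obtain ⟨M, hM0, hM⟩ := exists_dyadicSumLE_chain n C₀ a b hn hC₀ ha hab
  refine ⟨M, hM0, fun μ hg hd => ?_⟩
  have := hg.isLocallyFiniteMeasure
  filter_upwards [ae_exists_dbl_down (μ := μ) ha hd] with x hx t ht
  classical
  have ha0 : 0 < a := by linarith
  have hex := hx t ht
  set m := Nat.find hex with hm
  have hmd : Dbl μ a b x (t / a ^ m) := Nat.find_spec hex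
  refine ⟨t / a ^ m, by positivity, div_le_self ht.le (one_le_pow₀ ha.le), ?_, hmd⟩
  have h := hM μ hg x (t / a ^ m) m (by positivity) fun j hj hjm => ?_
  · rwa [mul_div_cancel₀ _ (by positivity)] at h
  · have h1 := Nat.find_min hex (m := m - j) (by omega)
    have h2 : a ^ j * (t / a ^ m) = t / a ^ (m - j) := by
      have : a ^ m = a ^ j * a ^ (m - j) := by rw [← pow_add]; congr 1; omega
      rw [this]; field_simp
    rwa [h2]

/-- The cube `Q~`. -/
theorem exists_tilde (n C₀ a b : ℝ) (hn : 0 < n) (hC₀ : 0 < C₀) (ha : 1 < a)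
    (hab : a ^ n < b) :
    ∃ M : ℝ, 0 ≤ M ∧ ∀ {d : ℕ} (μ : Measure (Fin d → ℝ)), Growth μ n C₀ →
      ∀ Q : Cube μ, ∃ R : Cube μ, R.center = Q.center ∧ Q.side ≤ R.side ∧ R.toSet = Q.tilde a b ∧
        R.Doubling a b ∧ DyadicSumLE μ n Q.center Q.side R.side M ∧
        (Q.Small → R.SmallEx a b) ∧ (Q.Doubling a b → R = Q) := by
  obtain ⟨M, hM0, hM⟩ := exists_dyadicSumLE_chain n C₀ a b hn hC₀ ha hab
  refine ⟨M, hM0, fun μ hg Q => ?_⟩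
  have ha0 : 0 < a := by linarith
  have hQ := Q.side_pos
  have hiff : ∀ m : ℕ, Q.DilDoubling a b (a ^ m) ↔ Dbl μ a b Q.center (a ^ m * Q.side) := by
    intro m
    unfold Cube.DilDoubling Cube.dil Dbl
    rw [mul_assoc]
  have hne : {m : ℕ | Q.DilDoubling a b (a ^ m)}.Nonempty := by
    obtain ⟨m, hm⟩ := exists_dbl_up hg hC₀ ha hab Q.center_mem hQ
    exact ⟨m, (hiff m).2 hm⟩
  set m := sInf {m : ℕ | Q.DilDoubling a b (a ^ m)} with hm
  have hmd : Dbl μ a b Q.center (a ^ m * Q.side) := (hiff m).1 (Nat.sInf_mem hne)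
  have hmin : ∀ j < m, ¬ Dbl μ a b Q.center (a ^ j * Q.side) := fun j hj h =>
    Nat.notMem_of_lt_sInf hj ((hiff j).2 h)
  refine ⟨⟨Q.center, a ^ m * Q.side, Q.center_mem, by positivity⟩, rfl, ?_, rfl, hmd, ?_, ?_, ?_⟩
  · exact le_mul_of_one_le_left hQ.le (one_le_pow₀ ha.le)
  · exact hM μ hg _ _ m hQ fun j _ hj => hmin j hj
  -- The cubes from Q up to just below Q~ are not doubling, so the next doubling cube below Q~ has
  -- side at most l(Q) ≤ 1.
  · intro hQs N hN
    obtain ⟨hN1, hN2⟩ := hN.1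
    simp only
    have hinv : ∀ k : ℕ, k ≤ m → a⁻¹ ^ k * (a ^ m * Q.side) = a ^ (m - k) * Q.side := by
      intro k hk
      rw [← mul_assoc, inv_pow]
      congr 1
      rw [inv_mul_eq_iff_eq_mul₀ (by positivity), ← pow_add]
      congr 1; omega
    rcases le_or_gt m N with h | h
    · calc a⁻¹ ^ N * (a ^ m * Q.side) ≤ a⁻¹ ^ m * (a ^ m * Q.side) := by
            gcongr ?_ * _
            exact pow_le_pow_of_le_one (by positivity) (inv_le_one_of_one_le₀ ha.le) h
        _ = Q.side := by rw [hinv _ le_rfl]; simp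
        _ ≤ 1 := hQs
    · exfalso
      refine hmin (m - N) (by omega) ?_
      rw [← hinv N h.le]
      unfold Cube.DilDoubling Cube.dil at hN2
      unfold Dbl
      rw [← mul_assoc]
      exact hN2
  · intro hd
    have h0 : m = 0 := by
      by_contra h
      exact hmin 0 (Nat.pos_of_ne_zero h) (by simpa [Dbl, Cube.Doubling, Cube.dil, Cube.toSet] using hd)
    rcases Q with ⟨c, l, hc, hl⟩
    simp [h0]

/-! ### A covering estimate -/

/-- Besicovitch covering estimate for two measures. -/
theorem exists_besicovitch_measure_le (d : ℕ) :
    ∃ N : ℕ, ∀ (μ ν : Measure (Fin d → ℝ)) (E U : Set (Fin d → ℝ)) (M : ENNReal) (r₀ : ℝ),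
      (∀ᵐ x ∂ν, x ∈ E → ∃ r, 0 < r ∧ r ≤ r₀ ∧ Metric.closedBall x r ⊆ U ∧
        ν (Metric.closedBall x r) ≤ M * μ (Metric.closedBall x r)) →
      ν E ≤ N * (M * μ U) := by
  obtain ⟨N, τ, hτ, hN⟩ := HasBesicovitchCovering.no_satelliteConfig (α := Fin d → ℝ)
  refine ⟨N, fun μ ν E U M r₀ h => ?_⟩
  set G : Set (Fin d → ℝ) := {x | x ∈ E ∧ ∃ r, 0 < r ∧ r ≤ r₀ ∧ Metric.closedBall x r ⊆ U ∧
        ν (Metric.closedBall x r) ≤ M * μ (Metric.closedBall x r)} with hG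
  choose r hr0 hr1 hr2 hr3 using fun x : G => x.2.2
  let q : Besicovitch.BallPackage G (Fin d → ℝ) := ⟨fun x => x.1, r, hr0, r₀, hr1⟩
  -- The selected balls form N disjoint families, N depending only on d, and cover all the centres.
  -- Within one family the μ-masses add up to at most μ U.
  obtain ⟨s, hs1, hs2⟩ := Besicovitch.exist_disjoint_covering_families hτ hN q
  have hc : ∀ i, (s i).Countable := fun i =>
    (hs1 i).countable_of_nonempty_interior fun j _ =>
      ⟨q.c j, Metric.ball_subset_interior_closedBall (Metric.mem_ball_self (hr0 j))⟩
  have hE : E ≤ᵐ[ν] (⋃ i, ⋃ j ∈ s i, Metric.closedBall (q.c j) (q.r j) : Set (Fin d → ℝ)) := by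
    filter_upwards [h] with x hx hxE
    have hxG : x ∈ G := ⟨hxE, hx hxE⟩
    have hx' := hs2 ⟨⟨x, hxG⟩, rfl⟩
    simp only [Set.mem_iUnion] at hx'
    obtain ⟨i, j, hj, hxj⟩ := hx'
    exact Set.mem_iUnion.2 ⟨i, Set.mem_iUnion₂.2 ⟨j, hj, Metric.ball_subset_closedBall hxj⟩⟩
  calc ν E ≤ ν (⋃ i, ⋃ j ∈ s i, Metric.closedBall (q.c j) (q.r j)) := measure_mono_ae hE
    _ ≤ ∑ i : Fin N, ν (⋃ j ∈ s i, Metric.closedBall (q.c j) (q.r j)) := measure_iUnion_fintype_le _ _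
    _ ≤ ∑ i : Fin N, M * μ U := by
        refine Finset.sum_le_sum fun i _ => ?_
        have := (hc i).to_subtype
        calc ν (⋃ j ∈ s i, Metric.closedBall (q.c j) (q.r j))
            ≤ ∑' j : s i, ν (Metric.closedBall (q.c j) (q.r j)) := measure_biUnion_le ν (hc i) _
          _ ≤ ∑' j : s i, M * μ (Metric.closedBall (q.c j) (q.r j)) :=
              ENNReal.tsum_le_tsum fun j => hr3 j
          _ = M * ∑' j : s i, μ (Metric.closedBall (q.c j) (q.r j)) := ENNReal.tsum_mul_left
          _ = M * μ (⋃ j ∈ s i, Metric.closedBall (q.c j) (q.r j)) := by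
              rw [measure_biUnion (hc i) (hs1 i) fun j _ => Metric.isClosed_closedBall.measurableSet]
          _ ≤ M * μ U := by
              gcongr
              exact Set.iUnion₂_subset fun j _ => hr2 j
    _ = N * (M * μ U) := by simp

/-- A nonnegative function whose averages over suitable cubes are at most `M` has integral at most
`N * M * μ U`. -/
theorem exists_integral_le_of_cubes (d : ℕ) :
    ∃ N : ℕ, ∀ (μ : Measure (Fin d → ℝ)) [IsLocallyFiniteMeasure μ] (g : (Fin d → ℝ) → ℝ),
      LocallyIntegrable g μ → (∀ x, 0 ≤ g x) →
      ∀ (y : Fin d → ℝ) (l l' M t : ℝ), 0 ≤ M →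
      (∀ᵐ x ∂μ, x ∈ Metric.closedBall y l → ∃ s, 0 < s ∧ s ≤ t ∧
        Metric.closedBall x (s / 2) ⊆ Metric.closedBall y l' ∧
        ∫ z in Metric.closedBall x (s / 2), g z ∂μ ≤ M * μ.real (Metric.closedBall x (s / 2))) →
      ∫ z in Metric.closedBall y l, g z ∂μ ≤ N * (M * μ.real (Metric.closedBall y l')) := by
  obtain ⟨N, hN⟩ := exists_besicovitch_measure_le d
  refine ⟨N, fun μ _ g hg hg0 y l l' M t hM h => ?_⟩
  have hint : ∀ x r, IntegrableOn g (Metric.closedBall x r) μ := fun x r =>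
    hg.integrableOn_isCompact (isCompact_closedBall x r)
  have hν : ∀ x r, (μ.withDensity fun z => ENNReal.ofReal (g z)) (Metric.closedBall x r) =
      ENNReal.ofReal (∫ z in Metric.closedBall x r, g z ∂μ) := by
    intro x r
    rw [withDensity_apply _ Metric.isClosed_closedBall.measurableSet,
      ofReal_integral_eq_lintegral_ofReal (hint x r) (Filter.Eventually.of_forall hg0)]
  -- The covering estimate is applied to ν = g μ; absolute continuity carries the almost everywhere
  -- hypothesis from μ to ν.
  have hmain := hN μ (μ.withDensity fun z => ENNReal.ofReal (g z)) (Metric.closedBall y l)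
    (Metric.closedBall y l') (ENNReal.ofReal M) (t / 2) ?_
  · rw [hν] at hmain
    refine (ENNReal.ofReal_le_ofReal_iff (by positivity)).1 (hmain.trans (le_of_eq ?_))
    rw [ENNReal.ofReal_mul (by positivity), ENNReal.ofReal_mul hM, ENNReal.ofReal_natCast,
      Measure.real, ENNReal.ofReal_toReal measure_closedBall_lt_top.ne]
  · refine (withDensity_absolutelyContinuous μ _).ae_le ?_
    filter_upwards [h] with x hx hxy
    obtain ⟨s, hs0, hst, hsub, hle⟩ := hx hxy
    refine ⟨s / 2, by positivity, by linarith, hsub, ?_⟩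
    rw [hν]
    refine (ENNReal.ofReal_le_ofReal hle).trans (le_of_eq ?_)
    rw [ENNReal.ofReal_mul hM, Measure.real, ENNReal.ofReal_toReal measure_closedBall_lt_top.ne]

/-! ### Averages -/

theorem _root_.MeasureTheory.LocallyIntegrable.abs {f : (Fin d → ℝ) → ℝ}
    (hf : LocallyIntegrable f μ) : LocallyIntegrable (fun x => |f x|) μ := fun x => by
  obtain ⟨s, hs, hi⟩ := hf x
  exact ⟨s, hs, hi.abs⟩

theorem Cube.measureReal_toSet_pos [IsLocallyFiniteMeasure μ] (Q : Cube μ) :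
    0 < μ.real Q.toSet :=
  measureReal_closedBall_pos Q.center_mem (half_pos Q.side_pos)

theorem Cube.measureReal_dil_pos [IsLocallyFiniteMeasure μ] (Q : Cube μ) {t : ℝ} (ht : 0 < t) :
    0 < μ.real (Q.dil t) :=
  measureReal_closedBall_pos Q.center_mem (half_pos (mul_pos ht Q.side_pos))

theorem Cube.measureReal_dil_mono [IsLocallyFiniteMeasure μ] (Q : Cube μ) {t t' : ℝ}
    (h : t ≤ t') : μ.real (Q.dil t) ≤ μ.real (Q.dil t') := by
  have := Q.side_pos
  exact measureReal_closedBall_mono (Metric.closedBall_subset_closedBall (by gcongr))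

theorem Cube.measureReal_toSet_le_dil [IsLocallyFiniteMeasure μ] (Q : Cube μ) {t : ℝ}
    (h : 1 ≤ t) : μ.real Q.toSet ≤ μ.real (Q.dil t) := by
  have := Q.measureReal_dil_mono h
  simpa [Cube.dil, Cube.toSet] using this

theorem Cube.measure_toSet_lt_top [IsLocallyFiniteMeasure μ] (Q : Cube μ) : μ Q.toSet < ⊤ :=
  measure_closedBall_lt_top

theorem Cube.integrableOn {f : (Fin d → ℝ) → ℝ} (hf : LocallyIntegrable f μ) (Q : Cube μ) :
    IntegrableOn f Q.toSet μ :=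
  hf.integrableOn_isCompact (isCompact_closedBall _ _)

theorem Cube.integrableOn_sub_const [IsLocallyFiniteMeasure μ] {f : (Fin d → ℝ) → ℝ}
    (hf : LocallyIntegrable f μ) (Q : Cube μ) (c : ℝ) :
    IntegrableOn (fun x => |f x - c|) Q.toSet μ :=
  ((Q.integrableOn hf).sub (integrableOn_const Q.measure_toSet_lt_top.ne)).abs

/-- The oscillation about one constant is controlled by that about another one. -/
theorem Cube.integral_abs_sub_le [IsLocallyFiniteMeasure μ] {f : (Fin d → ℝ) → ℝ}
    (hf : LocallyIntegrable f μ) (Q : Cube μ) (c c' : ℝ) :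
    ∫ x in Q.toSet, |f x - c'| ∂μ ≤
      ∫ x in Q.toSet, |f x - c| ∂μ + |c - c'| * μ.real Q.toSet := by
  have h1 : ∫ x in Q.toSet, |f x - c'| ∂μ ≤ ∫ x in Q.toSet, (|f x - c| + |c - c'|) ∂μ := by
    refine integral_mono (Q.integrableOn_sub_const hf c')
      ((Q.integrableOn_sub_const hf c).add (integrableOn_const Q.measure_toSet_lt_top.ne))
      fun x => ?_
    exact abs_sub_le (f x) c c'
  refine h1.trans (le_of_eq ?_)
  rw [integral_add (Q.integrableOn_sub_const hf c)
    (integrableOn_const Q.measure_toSet_lt_top.ne)]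
  simp [mul_comm]

theorem Cube.integral_abs_sub_le_abs [IsLocallyFiniteMeasure μ] {f : (Fin d → ℝ) → ℝ}
    (hf : LocallyIntegrable f μ) (Q : Cube μ) (c : ℝ) :
    ∫ x in Q.toSet, |f x - c| ∂μ ≤ ∫ x in Q.toSet, |f x| ∂μ + |c| * μ.real Q.toSet := by
  simpa using Q.integral_abs_sub_le hf 0 c

theorem Cube.integral_abs_le [IsLocallyFiniteMeasure μ] {f : (Fin d → ℝ) → ℝ}
    (hf : LocallyIntegrable f μ) (Q : Cube μ) (c : ℝ) :
    ∫ x in Q.toSet, |f x| ∂μ ≤ ∫ x in Q.toSet, |f x - c| ∂μ + |c| * μ.real Q.toSet := by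
  simpa using Q.integral_abs_sub_le hf c 0

theorem Cube.abs_mean_sub_mul_le [IsLocallyFiniteMeasure μ] {f : (Fin d → ℝ) → ℝ}
    (hf : LocallyIntegrable f μ) (Q : Cube μ) (c : ℝ) :
    |mean μ f Q.toSet - c| * μ.real Q.toSet ≤ ∫ x in Q.toSet, |f x - c| ∂μ := by
  have hpos := Q.measureReal_toSet_pos
  have h1 : (mean μ f Q.toSet - c) * μ.real Q.toSet = ∫ x in Q.toSet, (f x - c) ∂μ := by
    rw [integral_sub (Q.integrableOn hf) (integrableOn_const Q.measure_toSet_lt_top.ne)]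
    simp only [mean, MeasureTheory.integral_const, smul_eq_mul, MeasurableSet.univ,
      measureReal_restrict_apply, Set.univ_inter]
    field_simp
  rw [← abs_of_pos hpos, ← abs_mul, h1]
  exact abs_integral_le_integral_abs

theorem Cube.abs_mean_sub_le [IsLocallyFiniteMeasure μ] {f : (Fin d → ℝ) → ℝ}
    (hf : LocallyIntegrable f μ) (Q : Cube μ) (c : ℝ) :
    |mean μ f Q.toSet - c| ≤ (μ.real Q.toSet)⁻¹ * ∫ x in Q.toSet, |f x - c| ∂μ := by
  rw [← div_eq_inv_mul, le_div_iff₀ Q.measureReal_toSet_pos]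
  exact Q.abs_mean_sub_mul_le hf c

theorem Cube.abs_mean_le [IsLocallyFiniteMeasure μ] {f : (Fin d → ℝ) → ℝ}
    (hf : LocallyIntegrable f μ) (Q : Cube μ) :
    |mean μ f Q.toSet| ≤ (μ.real Q.toSet)⁻¹ * ∫ x in Q.toSet, |f x| ∂μ := by
  simpa using Q.abs_mean_sub_le hf 0

/-- The oscillation about the mean is at most twice that about any constant. -/
theorem Cube.integral_abs_sub_mean_le [IsLocallyFiniteMeasure μ] {f : (Fin d → ℝ) → ℝ}
    (hf : LocallyIntegrable f μ) (Q : Cube μ) (c : ℝ) :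
    ∫ x in Q.toSet, |f x - mean μ f Q.toSet| ∂μ ≤ 2 * ∫ x in Q.toSet, |f x - c| ∂μ := by
  have h1 := Q.integral_abs_sub_le hf c (mean μ f Q.toSet)
  have h2 := Q.abs_mean_sub_mul_le hf c
  rw [abs_sub_comm] at h1
  linarith

theorem inv_mul_le_iff_le_mul_real {a x C : ℝ} (ha : 0 < a) : a⁻¹ * x ≤ C ↔ x ≤ C * a := by
  rw [inv_mul_le_iff₀ ha, mul_comm]

/-! ### Families of cubes -/

theorem Cube.toSet_subset_toSet {Q R : Cube μ} (h : dist Q.center R.center + Q.side / 2 ≤ R.side / 2) :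
    Q.toSet ⊆ R.toSet :=
  Metric.closedBall_subset_closedBall' (by linarith)

/-- Two opposite corners of Q are at sup distance l(Q). In dimension 0 there are no corners and the
claim fails. -/
theorem Cube.side_le_of_subset (hd : 0 < d) {Q R : Cube μ} (h : Q.toSet ⊆ R.toSet) :
    Q.side ≤ R.side := by
  have : Nonempty (Fin d) := ⟨⟨0, hd⟩⟩
  have hQ := Q.side_pos
  set e : Fin d → ℝ := fun _ => Q.side / 2 with he
  have hne : ‖e‖ = Q.side / 2 := by
    rw [he, pi_norm_const, Real.norm_eq_abs, abs_of_pos (by positivity)]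
  have h1 : Q.center + e ∈ R.toSet := h (by simp [Cube.toSet, hne])
  have h2 : Q.center - e ∈ R.toSet := h (by simp [Cube.toSet, hne])
  have h3 := dist_triangle_right (Q.center + e) (Q.center - e) R.center
  have h4 : dist (Q.center + e) (Q.center - e) = Q.side := by
    rw [dist_eq_norm]
    have : Q.center + e - (Q.center - e) = (2 : ℝ) • e := by
      ext i; simp; ring
    rw [this, norm_smul, hne]; norm_num; ring
  have h5 := Metric.mem_closedBall.1 h1
  have h6 := Metric.mem_closedBall.1 h2
  linarith

theorem Cube.Small.smallEx {a b : ℝ} (ha : 1 < a) {Q : Cube μ} (h : Q.Small) : Q.SmallEx a b := by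
  intro N _
  have h1 : a⁻¹ ^ N ≤ 1 := pow_le_one₀ (by positivity) (inv_le_one_of_one_le₀ ha.le)
  calc a⁻¹ ^ N * Q.side ≤ 1 * Q.side := by gcongr; exact Q.side_pos.le
    _ ≤ 1 := by rw [one_mul]; exact h

/-- Since N ≥ 1, passing to Q' divides the side by at least α. In particular a cube of side exactly
α belongs to 𝒬_ex ∖ 𝒬 without any doubling assumption. -/
theorem Cube.smallEx_of_side_le {a b : ℝ} (ha : 1 < a) {Q : Cube μ} (h : Q.side ≤ a) :
    Q.SmallEx a b := by
  intro N hN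
  have ha0 : 0 < a := by linarith
  have h1 : a⁻¹ ^ N ≤ a⁻¹ := pow_le_of_le_one (by positivity) (inv_le_one_of_one_le₀ ha.le)
    (Nat.one_le_iff_ne_zero.1 hN.1.1)
  calc a⁻¹ ^ N * Q.side ≤ a⁻¹ * a := by
        gcongr; exact Q.side_pos.le
    _ = 1 := inv_mul_cancel₀ ha0.ne'

theorem Cube.Doubling.measureReal_dil_le [IsLocallyFiniteMeasure μ] {a b η : ℝ} {Q : Cube μ}
    (h : Q.Doubling a b) (hη : η ≤ a) : μ.real (Q.dil η) ≤ b * μ.real Q.toSet :=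
  (Q.measureReal_dil_mono hη).trans h

theorem rpow_lt_of_pow_lt {n a b : ℝ} (hnd : n ≤ d) (ha : 1 < a) (hab : a ^ d < b) :
    a ^ n < b := by
  refine lt_of_le_of_lt ?_ hab
  rw [← Real.rpow_natCast]
  exact Real.rpow_le_rpow_of_exponent_le ha.le hnd

/-! ### Consequences of the conditions defining the fourth space -/

/-- Q is compared with a concentric doubling cube R of 𝒬_ex ∖ 𝒬, for which |m_R f| ≤ A. The scales
up to 1 contribute M to K_{Q,R}; those above it contribute a constant. -/
theorem exists_abs_mean_le_of_bound4 (n C₀ α β : ℝ) (hn : 0 < n) (hC₀ : 0 < C₀) (hα : 1 < α)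
    (hβ : α ^ n < β) :
    ∃ C : ℝ, 0 ≤ C ∧ ∀ {d : ℕ} (μ : Measure (Fin d → ℝ)), Growth μ n C₀ →
      ∀ (f : (Fin d → ℝ) → ℝ) (A : ℝ), LocallyIntegrable f μ → 0 ≤ A → Bound4 μ n α β f A →
      ∀ (Q : Cube μ) (M : ℝ), Q.Doubling α β → Q.Small → DyadicSumLE μ n Q.center Q.side 1 M →
        |mean μ f Q.toSet| ≤ (C + M) * A := by
  obtain ⟨M₁, hM₁, h₁⟩ := exists_doubling_above n C₀ α β hn hC₀ hα hβ
  obtain ⟨M₂, hM₂, h₂⟩ := exists_dyadicSumLE_ratio n C₀ hC₀ 2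
  refine ⟨2 + M₁ + M₂, by positivity, fun μ hg f A hf hA hB Q M hQd hQs hQM => ?_⟩
  have := hg.isLocallyFiniteMeasure
  obtain ⟨T, hT, hT1, hTM, hTd, hTs⟩ := h₁ μ hg Q.center Q.center_mem 1 one_pos
  set R : Cube μ := ⟨Q.center, T, Q.center_mem, hT⟩ with hR
  have hRn : ¬ R.Small := not_le.2 hT1
  have hK : Q.K n R ≤ 1 + (M + M₁ + M₂) :=
    K_le_of_dyadicSumLE ((hQM.trans hTM).trans (h₂ μ hg Q.center T (2 * T) hT le_rfl))
  have hsub : Q.toSet ⊆ R.toSet := by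
    apply Cube.toSet_subset_toSet
    have : Q.side ≤ 1 := hQs
    simp only [hR, dist_self]; linarith
  have h3 := hB.2.1 Q R hsub hQd hTd hQs (hTs le_rfl)
  have h4 := (R.abs_mean_le hf).trans (hB.2.2 R hTd (hTs le_rfl) hRn)
  have h5 : A * Q.K n R ≤ A * (1 + (M + M₁ + M₂)) := by gcongr
  have h6 := abs_sub_abs_le_abs_sub (mean μ f Q.toSet) (mean μ f R.toSet)
  linarith

theorem Cube.closedBall_subset_dil {Q : Cube μ} {x : Fin d → ℝ} {s ρ : ℝ}
    (hx : x ∈ Q.toSet) (hs : s ≤ (ρ - 1) * Q.side) :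
    Metric.closedBall x (s / 2) ⊆ Q.dil ρ := by
  have := Metric.mem_closedBall.1 hx
  exact Metric.closedBall_subset_closedBall' (by linarith)

/-- Almost every point of Q is the centre of a small doubling cube S inside ρQ, with few scales lost
between l(S) and 1. There the mean and the oscillation are O(A), and the covering estimate sums up.
Membership of Q in 𝒬_ex is not needed, which is what RBMO requires. -/
theorem exists_integral_le_of_bound4 (d : ℕ) (n C₀ α β ρ : ℝ) (hn : 0 < n) (hnd : n ≤ d)
    (hC₀ : 0 < C₀) (hα : 1 < α) (hβ : α ^ d < β) (hρ : 1 < ρ) :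
    ∃ C : ℝ, 0 ≤ C ∧ ∀ (μ : Measure (Fin d → ℝ)), Growth μ n C₀ →
      ∀ (f : (Fin d → ℝ) → ℝ) (A : ℝ), LocallyIntegrable f μ → 0 ≤ A → Bound4 μ n α β f A →
      ∀ Q : Cube μ, ¬ Q.Small → ∫ x in Q.toSet, |f x| ∂μ ≤ C * A * μ.real (Q.dil ρ) := by
  have hβ' := rpow_lt_of_pow_lt hnd hα hβ
  -- Cubes of side at most c are in 𝒬, and those centred in Q remain inside ρQ because l(Q) > 1.
  set c : ℝ := min 1 (ρ - 1) with hc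
  have hc0 : 0 < c := lt_min one_pos (by linarith)
  obtain ⟨M₁, hM₁, h₁⟩ := exists_doubling_below n C₀ α β hn hC₀ hα hβ'
  obtain ⟨M₂, hM₂, h₂⟩ := exists_dyadicSumLE_ratio n C₀ hC₀ c⁻¹
  obtain ⟨C, hC, h₃⟩ := exists_abs_mean_le_of_bound4 n C₀ α β hn hC₀ hα hβ'
  obtain ⟨N, hN⟩ := exists_integral_le_of_cubes d
  refine ⟨N * (1 + (C + (M₁ + M₂))), by positivity, fun μ hg f A hf hA hB Q hQ => ?_⟩
  have := hg.isLocallyFiniteMeasure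
  refine (hN μ (fun x => |f x|) hf.abs (fun x => abs_nonneg _) Q.center (Q.side / 2)
    (ρ * Q.side / 2) ((1 + (C + (M₁ + M₂))) * A) c (by positivity) ?_).trans
    (le_of_eq (by simp only [Cube.dil]; ring))
  filter_upwards [h₁ μ hg hβ, Measure.support_mem_ae (μ := μ)] with x hx hxs hxQ
  obtain ⟨s, hs0, hsc, hsM, hsd⟩ := hx c hc0
  set S : Cube μ := ⟨x, s, hxs, hs0⟩ with hS
  have hSs : S.Small := hsc.trans (min_le_left _ _)
  have hQ1 : 1 < Q.side := not_le.1 hQ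
  refine ⟨s, hs0, hsc, Cube.closedBall_subset_dil hxQ ?_, ?_⟩
  · have : c ≤ ρ - 1 := min_le_right _ _
    nlinarith
  · have h4 := h₃ μ hg f A hf hA hB S (M₁ + M₂) hsd hSs
      (hsM.trans (h₂ μ hg x c 1 hc0 (by rw [inv_mul_cancel₀ hc0.ne'])))
    have h5 := (inv_mul_le_iff_le_mul_real S.measureReal_toSet_pos).1 (hB.1 S hsd hSs)
    have h6 := S.integral_abs_le hf (mean μ f S.toSet)
    have h7 := mul_le_mul_of_nonneg_right h4 S.measureReal_toSet_pos.le
    change ∫ x in S.toSet, |f x| ∂μ ≤ _ * μ.real S.toSet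
    linarith

/-- Q is covered by doubling cubes S inside ρQ, on each of which f oscillates by at most A about m_S
f. It remains to show that m_S f and the mean over Q~ differ by O(A); this is `key`. -/
theorem exists_oscillation_le_of_bound4 (d : ℕ) (n C₀ α β ρ : ℝ) (hn : 0 < n) (hnd : n ≤ d)
    (hC₀ : 0 < C₀) (hα : 1 < α) (hβ : α ^ d < β) (hρ : 1 < ρ) :
    ∃ C : ℝ, 0 ≤ C ∧ ∀ (μ : Measure (Fin d → ℝ)), Growth μ n C₀ →
      ∀ (f : (Fin d → ℝ) → ℝ) (A : ℝ), LocallyIntegrable f μ → 0 ≤ A → Bound4 μ n α β f A →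
      ∀ Q : Cube μ, Q.Small → ∫ x in Q.toSet, |f x - mean μ f (Q.tilde α β)| ∂μ ≤
        C * A * μ.real (Q.dil ρ) := by
  have hβ' := rpow_lt_of_pow_lt hnd hα hβ
  set c : ℝ := min 1 (ρ - 1) with hc
  have hc0 : 0 < c := lt_min one_pos (by linarith)
  obtain ⟨M₁, hM₁, h₁⟩ := exists_doubling_below n C₀ α β hn hC₀ hα hβ'
  obtain ⟨M₂, hM₂, h₂⟩ := exists_dyadicSumLE_ratio n C₀ hC₀ c⁻¹
  obtain ⟨M₃, hM₃, h₃⟩ := exists_tilde n C₀ α β hn hC₀ hα hβ'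
  obtain ⟨M₄, hM₄, h₄⟩ := exists_dyadicSumLE_ratio n C₀ hC₀ 4
  obtain ⟨M₅, hM₅, h₅⟩ := exists_doubling_above n C₀ α β hn hC₀ hα hβ'
  obtain ⟨C, hC, h₆⟩ := exists_abs_mean_le_of_bound4 n C₀ α β hn hC₀ hα hβ'
  obtain ⟨N, hN⟩ := exists_integral_le_of_cubes d
  set B : ℝ := M₁ + M₂ + 2 ^ n * M₃ + M₄ with hBdef
  have hB0 : 0 ≤ B := by positivity
  set D : ℝ := (1 + (B + M₅ + M₄)) + (1 + 2 ^ n * (M₅ + M₄)) + (C + B) + (C + M₄ + 1) with hD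
  have hD0 : 0 ≤ D := by positivity
  refine ⟨N * (1 + D), by positivity, fun μ hg f A hf hA hB Q hQ => ?_⟩
  have := hg.isLocallyFiniteMeasure
  obtain ⟨R, hRc, hQR, hRt, hRd, hRM, hRs, -⟩ := h₃ μ hg Q
  rw [← hRt]
  have hQ0 := Q.side_pos
  have hR0 := R.side_pos
  have hQ1 : Q.side ≤ 1 := hQ
  refine (hN μ (fun x => |f x - mean μ f R.toSet|)
    (hf.sub (locallyIntegrable_const _)).abs (fun x => abs_nonneg _) Q.center (Q.side / 2)
    (ρ * Q.side / 2) ((1 + D) * A) (c * Q.side) (by positivity) ?_).trans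
    (le_of_eq (by simp only [Cube.dil]; ring))
  filter_upwards [h₁ μ hg hβ, Measure.support_mem_ae (μ := μ)] with x hx hxs hxQ
  obtain ⟨s, hs0, hsc, hsM, hsd⟩ := hx (c * Q.side) (by positivity)
  set S : Cube μ := ⟨x, s, hxs, hs0⟩ with hS
  have hcQ : c * Q.side ≤ Q.side := mul_le_of_le_one_left hQ0.le (min_le_left _ _)
  have hsQ : s ≤ Q.side := hsc.trans hcQ
  have hSs : S.Small := hsQ.trans hQ
  have hdist : dist x Q.center ≤ Q.side / 2 := Metric.mem_closedBall.1 hxQ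
  refine ⟨s, hs0, hsc, Cube.closedBall_subset_dil hxQ (hsc.trans (by
    gcongr; exact min_le_right _ _)), ?_⟩
  -- Four stretches: the non-doubling chain up to c l(Q), a bounded ratio up to l(Q), the chain from
  -- Q to Q~ re-centred at x (possibly empty), and a bounded ratio up to 2 l(R).
  have hchain : DyadicSumLE μ n x s (2 * R.side) B := by
    refine ((hsM.trans (h₂ μ hg x (c * Q.side) Q.side (by positivity) ?_)).trans
      (mid := Q.side) (hi := R.side / 2) ?_).trans (h₄ μ hg x _ _ (by positivity) (by linarith))
    · rw [inv_mul_cancel_left₀ hc0.ne']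
    · exact (hRM.subset (by linarith) (by linarith)).shift hn hdist
  have key : |mean μ f S.toSet - mean μ f R.toSet| ≤ D * A := by
    set t : ℝ := min 1 (2 * R.side) with ht
    have ht0 : 0 < t := lt_min one_pos (by positivity)
    have hst : s ≤ t := le_min hSs (by linarith)
    -- If 2 l(R) ≤ 1, both S and R lie in a doubling cube P of 𝒬_ex with bounded coefficients.
    -- Otherwise the chain reaches scale 1 and each of the two means is O(A) separately.
    rcases le_or_gt (2 * R.side) 1 with hcase | hcase
    · have ht' : t = 2 * R.side := min_eq_right hcase
      obtain ⟨T, hT, hT1, hTM, hTd, hTs⟩ := h₅ μ hg x hxs t ht0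
      have hTs := hTs (min_le_left _ _)
      set P : Cube μ := ⟨x, T, hxs, hT⟩ with hP
      have hSP : S.toSet ⊆ P.toSet := by
        apply Cube.toSet_subset_toSet
        simp only [hS, hP, dist_self]; linarith
      have hRP : R.toSet ⊆ P.toSet := by
        apply Cube.toSet_subset_toSet
        rw [hRc, dist_comm]
        simp only [hP]
        linarith
      have hRs' : R.Small := by unfold Cube.Small; linarith
      have hK1 : S.K n P ≤ 1 + (B + M₅ + M₄) := by
        refine K_le_of_dyadicSumLE (((ht' ▸ hchain).trans hTM).trans
          (h₄ μ hg x T (2 * T) hT (by linarith)))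
      have hK2 : R.K n P ≤ 1 + 2 ^ n * (M₅ + M₄) := by
        refine K_le_of_dyadicSumLE ?_
        refine DyadicSumLE.shift hn (x := x) (((ht' ▸ hTM).trans
          (h₄ μ hg x T (2 * (2 * T)) hT (by linarith)))) ?_
        rw [hRc, dist_comm]; linarith
      have e1 := hB.2.1 S P hSP hsd hTd hSs hTs
      have e2 := hB.2.1 R P hRP hRd hTd hRs' hTs
      rw [abs_sub_comm] at e2
      have e3 := abs_sub_le (mean μ f S.toSet) (mean μ f P.toSet) (mean μ f R.toSet)
      have e4 : A * S.K n P ≤ A * (1 + (B + M₅ + M₄)) := by gcongr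
      have e5 : A * R.K n P ≤ A * (1 + 2 ^ n * (M₅ + M₄)) := by gcongr
      have e6 : 0 ≤ (C + B) * A := by positivity
      have e7 : 0 ≤ (C + M₄ + 1) * A := by positivity
      rw [hD]
      linarith
    · have e1 := h₆ μ hg f A hf hA hB S B hsd hSs (hchain.subset le_rfl hcase.le)
      have e2 : |mean μ f R.toSet| ≤ (C + M₄ + 1) * A := by
        by_cases hRs' : R.Small
        · have e3 := h₆ μ hg f A hf hA hB R M₄ hRd hRs' (h₄ μ hg _ _ _ hR0 (by linarith))
          linarith
        · have e3 := (R.abs_mean_le hf).trans (hB.2.2 R hRd (hRs hQ) hRs')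
          have e4 : 0 ≤ (C + M₄) * A := by positivity
          linarith
      have e3 := abs_sub (mean μ f S.toSet) (mean μ f R.toSet)
      have e4 : 0 ≤ ((1 + (B + M₅ + M₄)) + (1 + 2 ^ n * (M₅ + M₄))) * A := by positivity
      rw [hD]
      linarith
  have h5 := (inv_mul_le_iff_le_mul_real S.measureReal_toSet_pos).1 (hB.1 S hsd hSs)
  have h6 := S.integral_abs_sub_le hf (mean μ f S.toSet) (mean μ f R.toSet)
  have h7 := mul_le_mul_of_nonneg_right key S.measureReal_toSet_pos.le
  change ∫ x in S.toSet, |f x - mean μ f R.toSet| ∂μ ≤ _ * μ.real S.toSet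
  linarith

theorem exists_boundRBMO_of_bound4 (d : ℕ) (n C₀ η α β : ℝ) (hn : 0 < n) (hnd : n ≤ d)
    (hC₀ : 0 < C₀) (hη : 1 < η) (hα : 1 < α) (hβ : α ^ d < β) :
    ∃ C : ℝ, 0 ≤ C ∧ ∀ (μ : Measure (Fin d → ℝ)), Growth μ n C₀ →
      ∀ (f : (Fin d → ℝ) → ℝ) (A : ℝ), LocallyIntegrable f μ → 0 ≤ A → Bound4 μ n α β f A →
      BoundRBMO μ n η α β f (C * A) := by
  have hβ' := rpow_lt_of_pow_lt hnd hα hβ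
  have hβ0 : 0 < β := lt_trans (by positivity) hβ
  have hd : 0 < d := by exact_mod_cast hn.trans_le hnd
  obtain ⟨M₂, hM₂, h₂⟩ := exists_dyadicSumLE_ratio n C₀ hC₀ 2
  obtain ⟨M₃, hM₃, h₃⟩ := exists_tilde n C₀ α β hn hC₀ hα hβ'
  obtain ⟨M₅, hM₅, h₅⟩ := exists_doubling_above n C₀ α β hn hC₀ hα hβ'
  obtain ⟨C₁, hC₁, h₆⟩ := exists_integral_le_of_bound4 d n C₀ α β η hn hnd hC₀ hα hβ hη
  obtain ⟨C₂, hC₂, h₇⟩ := exists_integral_le_of_bound4 d n C₀ α β α hn hnd hC₀ hα hβ hα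
  obtain ⟨C₃, hC₃, h₈⟩ := exists_oscillation_le_of_bound4 d n C₀ α β η hn hnd hC₀ hα hβ hη
  refine ⟨C₁ + 2 * (C₂ * β) + C₃ + (2 + M₅ + M₂), by positivity,
    fun μ hg f A hf hA hB => ?_⟩
  have := hg.isLocallyFiniteMeasure
  -- The large-cube estimate with ρ = α, where doubling turns μ(αR) back into μ(R); R need not be in
  -- 𝒬_ex.
  have hlarge : ∀ R : Cube μ, ¬ R.Small → R.Doubling α β →
      |mean μ f R.toSet| ≤ C₂ * β * A := by
    intro R hR hRd
    refine (R.abs_mean_le hf).trans ((inv_mul_le_iff_le_mul_real R.measureReal_toSet_pos).2 ?_)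
    refine (h₇ μ hg f A hf hA hB R hR).trans ?_
    calc C₂ * A * μ.real (R.dil α) ≤ C₂ * A * (β * μ.real R.toSet) := by gcongr; exact hRd
      _ = _ := by ring
  constructor
  · intro Q
    rw [inv_mul_le_iff_le_mul_real (Q.measureReal_dil_pos (by linarith))]
    have hpos := (Q.measureReal_dil_pos (t := η) (by linarith)).le
    have hle := Q.measureReal_toSet_le_dil hη.le
    by_cases hQ : Q.Small
    · refine (h₈ μ hg f A hf hA hB Q hQ).trans ?_
      gcongr
      have : 0 ≤ 2 * (C₂ * β) := by positivity
      linarith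
    · obtain ⟨R, hRc, hQR, hRt, hRd, hRM, hRs, -⟩ := h₃ μ hg Q
      have hRn : ¬ R.Small := fun h => hQ (hQR.trans h)
      rw [← hRt]
      have e1 := Q.integral_abs_sub_le_abs hf (mean μ f R.toSet)
      have e2 := h₆ μ hg f A hf hA hB Q hQ
      have e3 : |mean μ f R.toSet| * μ.real Q.toSet ≤ C₂ * β * A * μ.real (Q.dil η) :=
        mul_le_mul (hlarge R hRn hRd) hle measureReal_nonneg (by positivity)
      have e4 : 0 ≤ (C₂ * β + C₃ + (2 + M₅ + M₂)) * A * μ.real (Q.dil η) := by positivity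
      linarith
  · intro Q R hQR hQd hRd
    have hK := one_le_K n Q R
    have hside := Cube.side_le_of_subset hd hQR
    by_cases hR : R.Small
    · have hQ : Q.Small := hside.trans hR
      refine (hB.2.1 Q R hQR hQd hRd hQ (hR.smallEx hα)).trans ?_
      gcongr
      refine le_mul_of_one_le_left hA ?_
      have : 0 ≤ C₁ + 2 * (C₂ * β) + C₃ + (M₅ + M₂) := by positivity
      linarith
    · have e1 := hlarge R hR hRd
      have e2 : |mean μ f Q.toSet| ≤ (C₂ * β + (2 + M₅ + M₂)) * A * Q.K n R := by
        by_cases hQ : Q.Small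
        -- R may fail to be in 𝒬_ex, so it is replaced by a concentric doubling enlargement P of Q
        -- that is; K_{Q,P} exceeds K_{Q,R} by at most a constant.
        · obtain ⟨T, hT, hT1, hTM, hTd, hTs⟩ := h₅ μ hg Q.center Q.center_mem 1 one_pos
          have hTs := hTs le_rfl
          set P : Cube μ := ⟨Q.center, T, Q.center_mem, hT⟩ with hP
          have hPn : ¬ P.Small := not_le.2 hT1
          have hQP : Q.toSet ⊆ P.toSet := by
            apply Cube.toSet_subset_toSet
            have : Q.side ≤ 1 := hQ
            simp only [hP, dist_self]; linarith
          have hK2 : Q.K n P ≤ Q.K n R + (M₅ + M₂) :=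
            K_le_K_add (t := 1) (not_le.1 hR)
              (hTM.trans (h₂ μ hg Q.center T (2 * T) hT le_rfl))
          have e3 := hB.2.1 Q P hQP hQd hTd hQ hTs
          have e4 := (P.abs_mean_le hf).trans (hB.2.2 P hTd hTs hPn)
          have e5 : A * Q.K n P ≤ A * (Q.K n R + (M₅ + M₂)) := by gcongr
          have e6 := abs_sub_abs_le_abs_sub (mean μ f Q.toSet) (mean μ f P.toSet)
          have e7 : A * (1 + M₅ + M₂) * 1 ≤ A * (1 + M₅ + M₂) * Q.K n R := by gcongr
          have e8 : 0 ≤ C₂ * β * A * Q.K n R := by positivity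
          linarith
        · have e3 := hlarge Q hQ hQd
          have e4 : C₂ * β * A * 1 ≤ C₂ * β * A * Q.K n R := by gcongr
          have e5 : 0 ≤ (2 + M₅ + M₂) * A * Q.K n R := by positivity
          linarith
      have e3 := abs_sub (mean μ f Q.toSet) (mean μ f R.toSet)
      have e4 : C₂ * β * A * 1 ≤ C₂ * β * A * Q.K n R := by gcongr
      have e5 : 0 ≤ (C₁ + C₃) * A * Q.K n R := by positivity
      linarith

/-! ### Comparison with the fourth space -/

/-- For η ≤ a a doubling cube satisfies μ(ηQ) ≤ b μ(Q), so normalising by either mass is equivalent.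
This is the role of η ≤ α in the first and third spaces. -/
theorem Cube.integral_le_of_doubling [IsLocallyFiniteMeasure μ] {a b η A I : ℝ} {Q : Cube μ}
    (hη : 1 < η) (hηa : η ≤ a) (hA : 0 ≤ A) (hQ : Q.Doubling a b)
    (h : (μ.real (Q.dil η))⁻¹ * I ≤ A) : (μ.real Q.toSet)⁻¹ * I ≤ b * A := by
  rw [inv_mul_le_iff_le_mul_real (Q.measureReal_dil_pos (by linarith))] at h
  rw [inv_mul_le_iff_le_mul_real Q.measureReal_toSet_pos]
  calc I ≤ A * μ.real (Q.dil η) := h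
    _ ≤ A * (b * μ.real Q.toSet) := by gcongr; exact hQ.measureReal_dil_le hηa
    _ = _ := by ring

theorem Cube.tilde_eq_of_doubling {n C₀ a b : ℝ} (hn : 0 < n) (hC₀ : 0 < C₀) (ha : 1 < a)
    (hab : a ^ n < b) (hg : Growth μ n C₀) {Q : Cube μ} (hQ : Q.Doubling a b) :
    Q.tilde a b = Q.toSet := by
  obtain ⟨M, -, h⟩ := exists_tilde n C₀ a b hn hC₀ ha hab
  obtain ⟨R, -, -, hRt, -, -, -, hR⟩ := h μ hg Q
  rw [← hRt, hR hQ]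

theorem Bound1.bound4 {n C₀ η α β A : ℝ} {f : (Fin d → ℝ) → ℝ} (hn : 0 < n) (hC₀ : 0 < C₀)
    (hη : 1 < η) (hα : 1 < α) (hβ : α ^ n < β) (hηα : η ≤ α) (hg : Growth μ n C₀) (hA : 0 ≤ A)
    (h : Bound1 μ n η α β f A) : Bound4 μ n α β f (β * A) := by
  have := hg.isLocallyFiniteMeasure
  have hβ1 : 1 ≤ β := (Real.one_lt_rpow hα hn).le.trans hβ.le
  refine ⟨fun Q hQd hQ => ?_, fun Q R hQR hQd hRd hQ hR => ?_, fun Q hQd hQe hQ => ?_⟩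
  · have h1 := h.1 Q hQ
    rw [Cube.tilde_eq_of_doubling hn hC₀ hα hβ hg hQd] at h1
    exact Cube.integral_le_of_doubling hη hηα hA hQd h1
  · refine (h.2.1 Q R hQR hQd hRd hQ hR).trans ?_
    have := one_le_K n Q R
    gcongr
    exact le_mul_of_one_le_left hA hβ1
  · exact Cube.integral_le_of_doubling hη hηα hA hQd (h.2.2 Q hQe hQ)

theorem Bound3.bound4 {n C₀ η α β A : ℝ} {f : (Fin d → ℝ) → ℝ} (hn : 0 < n)
    (hη : 1 < η) (hα : 1 < α) (hβ : α ^ n < β) (hηα : η ≤ α) (hg : Growth μ n C₀) (hA : 0 ≤ A)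
    (h : Bound3 μ n η α β f A) : Bound4 μ n α β f (2 * β * A) := by
  have := hg.isLocallyFiniteMeasure
  have hβ1 : 1 ≤ β := (Real.one_lt_rpow hα hn).le.trans hβ.le
  have h2 : β * A ≤ 2 * β * A := by
    have : 0 ≤ β * A := by positivity
    linarith
  refine ⟨fun Q hQd hQ => ?_, fun Q R hQR hQd hRd hQ hR => ?_, fun Q hQd hQe hQ => ?_⟩
  · exact (Cube.integral_le_of_doubling hη hηα hA hQd (h.1 Q hQ)).trans h2
  · refine (h.2.1 Q R hQR hQ hR).trans ?_
    have := one_le_K n Q R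
    have h3 : μ.real (Q.dil η) / μ.real Q.toSet ≤ β :=
      (div_le_iff₀ Q.measureReal_toSet_pos).2 (hQd.measureReal_dil_le hηα)
    have h4 : μ.real (R.dil η) / μ.real R.toSet ≤ β :=
      (div_le_iff₀ R.measureReal_toSet_pos).2 (hRd.measureReal_dil_le hηα)
    calc _ ≤ A * Q.K n R * (β + β) := by gcongr
      _ = _ := by ring
  · exact (Cube.integral_le_of_doubling hη hηα hA hQd (h.2.2 Q hQe hQ)).trans h2

/-- The comparison cube is the concentric one of side α: it is in 𝒬_ex ∖ 𝒬, and the conditions on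
the family F apply to non-doubling cubes as well. -/
theorem exists_abs_le_of_bound2 (n C₀ α β : ℝ) (hC₀ : 0 < C₀) (hα : 1 < α) :
    ∃ C : ℝ, 0 ≤ C ∧ ∀ {d : ℕ} (μ : Measure (Fin d → ℝ)), Growth μ n C₀ →
      ∀ (F : Cube μ → ℝ) (A : ℝ), 0 ≤ A →
      (∀ Q R : Cube μ, Q.toSet ⊆ R.toSet → Q.Small → R.SmallEx α β →
        |F Q - F R| ≤ A * Q.K n R) →
      (∀ R : Cube μ, R.SmallEx α β → ¬ R.Small → |F R| ≤ A) →
      ∀ (Q : Cube μ) (M : ℝ), Q.Small → DyadicSumLE μ n Q.center Q.side 1 M →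
        |F Q| ≤ (C + M) * A := by
  obtain ⟨M₂, hM₂, h₂⟩ := exists_dyadicSumLE_ratio n C₀ hC₀ (2 * α)
  refine ⟨2 + M₂, by positivity, fun μ hg F A hA hF hF' Q M hQs hQM => ?_⟩
  set R : Cube μ := ⟨Q.center, α, Q.center_mem, by linarith⟩ with hR
  have hRn : ¬ R.Small := not_le.2 hα
  have hRe : R.SmallEx α β := Cube.smallEx_of_side_le hα le_rfl
  have hK : Q.K n R ≤ 1 + (M + M₂) :=
    K_le_of_dyadicSumLE (hQM.trans (h₂ μ hg Q.center 1 (2 * α) one_pos (by linarith)))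
  have hsub : Q.toSet ⊆ R.toSet := by
    apply Cube.toSet_subset_toSet
    have : Q.side ≤ 1 := hQs
    simp only [hR, dist_self]; linarith
  have h3 := hF Q R hsub hQs hRe
  have h4 := hF' R hRe hRn
  have h5 : A * Q.K n R ≤ A * (1 + (M + M₂)) := by gcongr
  have h6 := abs_sub_abs_le_abs_sub (F Q) (F R)
  linarith

/-- The oscillation condition with `η` replaced by `ρ`, and its counterpart for large cubes. -/
theorem exists_integral_le_of_bound2 (d : ℕ) (n C₀ η α β ρ : ℝ) (hn : 0 < n) (hnd : n ≤ d)
    (hC₀ : 0 < C₀) (hη : 1 < η) (hα : 1 < α) (hρ : 1 < ρ) :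
    ∃ C : ℝ, 0 ≤ C ∧ ∀ (μ : Measure (Fin d → ℝ)), Growth μ n C₀ →
      ∀ (f : (Fin d → ℝ) → ℝ) (F : Cube μ → ℝ) (A : ℝ), LocallyIntegrable f μ → 0 ≤ A →
      (∀ Q : Cube μ, Q.Small → (μ.real (Q.dil η))⁻¹ * ∫ x in Q.toSet, |f x - F Q| ∂μ ≤ A) →
      (∀ Q R : Cube μ, Q.toSet ⊆ R.toSet → Q.Small → R.SmallEx α β →
        |F Q - F R| ≤ A * Q.K n R) →
      (∀ R : Cube μ, R.SmallEx α β → ¬ R.Small → |F R| ≤ A) →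
      (∀ Q : Cube μ, Q.Small → ∫ x in Q.toSet, |f x - F Q| ∂μ ≤ C * A * μ.real (Q.dil ρ)) ∧
      (∀ Q : Cube μ, ¬ Q.Small → ∫ x in Q.toSet, |f x| ∂μ ≤ C * A * μ.real (Q.dil ρ)) := by
  -- The covering uses (η, b)-doubling cubes, unrelated to α and β. Since b > η^d they exist at
  -- almost every centre, and on them μ(ηS) ≤ b μ(S).
  set b : ℝ := η ^ d + 1 with hb
  have hb0 : 0 < b := by positivity
  have hηb : η ^ d < b := by linarith
  have hηb' := rpow_lt_of_pow_lt hnd hη hηb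
  set c : ℝ := min 1 (ρ - 1) with hc
  have hc0 : 0 < c := lt_min one_pos (by linarith)
  obtain ⟨M₁, hM₁, h₁⟩ := exists_doubling_below n C₀ η b hn hC₀ hη hηb'
  obtain ⟨M₂, hM₂, h₂⟩ := exists_dyadicSumLE_ratio n C₀ hC₀ c⁻¹
  obtain ⟨M₄, hM₄, h₄⟩ := exists_dyadicSumLE_ratio n C₀ hC₀ 4
  obtain ⟨C, hC, h₃⟩ := exists_abs_le_of_bound2 n C₀ α β hC₀ hα
  obtain ⟨N, hN⟩ := exists_integral_le_of_cubes d
  set D : ℝ := (1 + (M₁ + M₂ + M₄)) + (1 + M₄) + (C + (M₁ + M₂ + M₄)) + (C + M₄) with hD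
  have hD0 : 0 ≤ D := by positivity
  refine ⟨N * (b + D), by positivity, fun μ hg f F A hf hA hF1 hF2 hF3 => ⟨fun Q hQ => ?_,
    fun Q hQ => ?_⟩⟩
  · have := hg.isLocallyFiniteMeasure
    have hQ0 := Q.side_pos
    have hQ1 : Q.side ≤ 1 := hQ
    refine (hN μ (fun x => |f x - F Q|)
      (hf.sub (locallyIntegrable_const _)).abs (fun x => abs_nonneg _) Q.center (Q.side / 2)
      (ρ * Q.side / 2) ((b + D) * A) (c * Q.side) (by positivity) ?_).trans
      (le_of_eq (by simp only [Cube.dil]; ring))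
    filter_upwards [h₁ μ hg hηb, Measure.support_mem_ae (μ := μ)] with x hx hxs hxQ
    obtain ⟨s, hs0, hsc, hsM, hsd⟩ := hx (c * Q.side) (by positivity)
    set S : Cube μ := ⟨x, s, hxs, hs0⟩ with hS
    have hcQ : c * Q.side ≤ Q.side := mul_le_of_le_one_left hQ0.le (min_le_left _ _)
    have hsQ : s ≤ Q.side := hsc.trans hcQ
    have hSs : S.Small := hsQ.trans hQ
    have hdist : dist x Q.center ≤ Q.side / 2 := Metric.mem_closedBall.1 hxQ
    refine ⟨s, hs0, hsc, Cube.closedBall_subset_dil hxQ (hsc.trans (by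
      gcongr; exact min_le_right _ _)), ?_⟩
    have hchain : DyadicSumLE μ n x s (4 * Q.side) (M₁ + M₂ + M₄) :=
      (hsM.trans (h₂ μ hg x (c * Q.side) Q.side (by positivity)
        (by rw [inv_mul_cancel_left₀ hc0.ne']))).trans (h₄ μ hg x _ _ hQ0 le_rfl)
    have key : |F S - F Q| ≤ D * A := by
      -- While 2Q is in 𝒬 it serves as a common larger cube for S and Q; otherwise l(Q) is
      -- comparable to 1 and F S, F Q are O(A) separately.
      rcases le_or_gt (2 * Q.side) 1 with hcase | hcase
      · set P : Cube μ := ⟨Q.center, 2 * Q.side, Q.center_mem, by positivity⟩ with hP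
        have hPs : P.Small := hcase
        have hSP : S.toSet ⊆ P.toSet := by
          apply Cube.toSet_subset_toSet
          simp only [hS, hP]; linarith
        have hQP : Q.toSet ⊆ P.toSet := by
          apply Cube.toSet_subset_toSet
          simp only [hP, dist_self]; linarith
        have hK1 : S.K n P ≤ 1 + (M₁ + M₂ + M₄) :=
          K_le_of_dyadicSumLE (hchain.subset le_rfl (by simp only [hP]; linarith))
        have hK2 : Q.K n P ≤ 1 + M₄ :=
          K_le_of_dyadicSumLE (h₄ μ hg _ _ _ hQ0 (by simp only [hP]; linarith))
        have e1 := hF2 S P hSP hSs (hPs.smallEx hα)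
        have e2 := hF2 Q P hQP hQ (hPs.smallEx hα)
        rw [abs_sub_comm] at e2
        have e3 := abs_sub_le (F S) (F P) (F Q)
        have e4 : A * S.K n P ≤ A * (1 + (M₁ + M₂ + M₄)) := by gcongr
        have e5 : A * Q.K n P ≤ A * (1 + M₄) := by gcongr
        have e6 : 0 ≤ ((C + (M₁ + M₂ + M₄)) + (C + M₄)) * A := by positivity
        rw [hD]
        linarith
      · have e1 := h₃ μ hg F A hA hF2 hF3 S _ hSs (hchain.subset le_rfl (by linarith))
        have e2 := h₃ μ hg F A hA hF2 hF3 Q M₄ hQ (h₄ μ hg _ _ _ hQ0 (by linarith))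
        have e3 := abs_sub (F S) (F Q)
        have e4 : 0 ≤ ((1 + (M₁ + M₂ + M₄)) + (1 + M₄)) * A := by positivity
        rw [hD]
        linarith
    have h5 := (inv_mul_le_iff_le_mul_real S.measureReal_toSet_pos).1
      (Cube.integral_le_of_doubling hη le_rfl hA (Q := S) (b := b) hsd (hF1 S hSs))
    have h6 := S.integral_abs_sub_le hf (F S) (F Q)
    have h7 := mul_le_mul_of_nonneg_right key S.measureReal_toSet_pos.le
    change ∫ x in S.toSet, |f x - F Q| ∂μ ≤ _ * μ.real S.toSet
    linarith
  · have := hg.isLocallyFiniteMeasure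
    refine (hN μ (fun x => |f x|) hf.abs (fun x => abs_nonneg _) Q.center (Q.side / 2)
      (ρ * Q.side / 2) ((b + D) * A) c (by positivity) ?_).trans
      (le_of_eq (by simp only [Cube.dil]; ring))
    filter_upwards [h₁ μ hg hηb, Measure.support_mem_ae (μ := μ)] with x hx hxs hxQ
    obtain ⟨s, hs0, hsc, hsM, hsd⟩ := hx c hc0
    set S : Cube μ := ⟨x, s, hxs, hs0⟩ with hS
    have hSs : S.Small := hsc.trans (min_le_left _ _)
    have hQ1 : 1 < Q.side := not_le.1 hQ
    refine ⟨s, hs0, hsc, Cube.closedBall_subset_dil hxQ ?_, ?_⟩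
    · have : c ≤ ρ - 1 := min_le_right _ _
      nlinarith
    · have h4 := h₃ μ hg F A hA hF2 hF3 S (M₁ + M₂) hSs
        (hsM.trans (h₂ μ hg x c 1 hc0 (by rw [inv_mul_cancel₀ hc0.ne'])))
      have h5 := (inv_mul_le_iff_le_mul_real S.measureReal_toSet_pos).1
        (Cube.integral_le_of_doubling hη le_rfl hA (Q := S) (b := b) hsd (hF1 S hSs))
      have h6 := S.integral_abs_le hf (F S)
      have h7 := mul_le_mul_of_nonneg_right h4 S.measureReal_toSet_pos.le
      have h8 : 0 ≤ ((1 + (M₁ + M₂ + M₄)) + (1 + M₄) + M₄ + (C + M₄)) * A * μ.real S.toSet := by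
        positivity
      change ∫ x in S.toSet, |f x| ∂μ ≤ _ * μ.real S.toSet
      rw [hD]
      linarith

/-- With ρ = α the improved estimates involve μ(αQ) ≤ β μ(Q) on doubling cubes. Hence m_Q f is
within O(A) of F Q for small Q, and is itself O(A) for large Q. -/
theorem exists_bound4_of_bound2 (d : ℕ) (n C₀ η α β : ℝ) (hn : 0 < n) (hnd : n ≤ d)
    (hC₀ : 0 < C₀) (hη : 1 < η) (hα : 1 < α) (hβ : α ^ d < β) :
    ∃ C : ℝ, 0 ≤ C ∧ ∀ (μ : Measure (Fin d → ℝ)), Growth μ n C₀ →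
      ∀ (f : (Fin d → ℝ) → ℝ) (A : ℝ), LocallyIntegrable f μ → 0 ≤ A →
        Bound2 μ n η α β f A → Bound4 μ n α β f (C * A) := by
  have hβ0 : 0 < β := lt_trans (by positivity) hβ
  obtain ⟨C, hC, h₁⟩ := exists_integral_le_of_bound2 d n C₀ η α β α hn hnd hC₀ hη hα hα
  refine ⟨2 * (β * C) + 2, by positivity, fun μ hg f A hf hA hB => ?_⟩
  have := hg.isLocallyFiniteMeasure
  obtain ⟨F, hF1, hF2, hF3⟩ := hB
  obtain ⟨hs, hl⟩ := h₁ μ hg f F A hf hA hF1 hF2 hF3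
  have hβC : 0 ≤ β * C * A := by positivity
  have hdbl : ∀ (Q : Cube μ) (I : ℝ), Q.Doubling α β → I ≤ C * A * μ.real (Q.dil α) →
      (μ.real Q.toSet)⁻¹ * I ≤ β * C * A := by
    intro Q I hQ hI
    have h1 := Cube.integral_le_of_doubling (I := I) hα le_rfl (A := C * A) (by positivity) hQ
      ((inv_mul_le_iff_le_mul_real (Q.measureReal_dil_pos (by linarith))).2 hI)
    linarith
  have hms : ∀ Q : Cube μ, Q.Doubling α β → Q.Small → |mean μ f Q.toSet - F Q| ≤ β * C * A :=
    fun Q hQd hQ => (Q.abs_mean_sub_le hf (F Q)).trans (hdbl Q _ hQd (hs Q hQ))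
  have hml : ∀ Q : Cube μ, Q.Doubling α β → ¬ Q.Small → |mean μ f Q.toSet| ≤ β * C * A :=
    fun Q hQd hQ => (Q.abs_mean_le hf).trans (hdbl Q _ hQd (hl Q hQ))
  refine ⟨fun Q hQd hQ => ?_, fun Q R hQR hQd hRd hQ hR => ?_, fun Q hQd hQe hQ => ?_⟩
  · have h1 := hdbl Q _ hQd (hs Q hQ)
    have h2 := Q.integral_abs_sub_mean_le hf (F Q)
    have h3 := mul_le_mul_of_nonneg_left h2 (inv_nonneg.2 Q.measureReal_toSet_pos.le)
    linarith
  · have hK := one_le_K n Q R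
    have e1 := hms Q hQd hQ
    have e2 := hF2 Q R hQR hQ hR
    have e3 := abs_sub_le (mean μ f Q.toSet) (F Q) (F R)
    have e4 := abs_sub_le (mean μ f Q.toSet) (F R) (mean μ f R.toSet)
    have e5 : |F R - mean μ f R.toSet| ≤ (β * C + 1) * A := by
      by_cases hRs : R.Small
      · have := hms R hRd hRs
        rw [abs_sub_comm] at this
        linarith
      · have h1 := abs_sub (F R) (mean μ f R.toSet)
        have h2 := hml R hRd hRs
        have h3 := hF3 R hR hRs
        linarith
    have e6 : (2 * (β * C) + 1) * A * 1 ≤ (2 * (β * C) + 1) * A * Q.K n R := by gcongr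
    linarith
  · have h1 := hdbl Q _ hQd (hl Q hQ)
    linarith

/-- In each of the four spaces the conditions defining the fourth one are satisfied. -/
theorem exists_bound4_of_bound (d : ℕ) (n C₀ η α β : ℝ) (hn : 0 < n) (hnd : n ≤ d)
    (hC₀ : 0 < C₀) (hη : 1 < η) (hα : 1 < α) (hβ : α ^ d < β) :
    ∃ C : ℝ, 0 ≤ C ∧ ∀ (μ : Measure (Fin d → ℝ)), Growth μ n C₀ → ∀ i : Index,
      (i ≠ Index.two → η ≤ α) →
      ∀ (f : (Fin d → ℝ) → ℝ) (A : ℝ), LocallyIntegrable f μ → 0 ≤ A →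
        Bound i μ n η α β f A → Bound4 μ n α β f (C * A) := by
  have hβ' := rpow_lt_of_pow_lt hnd hα hβ
  have hβ1 : 1 ≤ β := (Real.one_lt_rpow hα hn).le.trans hβ'.le
  obtain ⟨C, hC, h₂⟩ := exists_bound4_of_bound2 d n C₀ η α β hn hnd hC₀ hη hα hβ
  have hmono : ∀ {μ : Measure (Fin d → ℝ)} {f : (Fin d → ℝ) → ℝ} {A A' : ℝ}, A ≤ A' →
      Bound4 μ n α β f A → Bound4 μ n α β f A' := fun hAA' h =>
    ⟨fun Q h1 h2 => (h.1 Q h1 h2).trans hAA', fun Q R h0 h1 h2 h3 h4 =>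
      (h.2.1 Q R h0 h1 h2 h3 h4).trans (by
        have := one_le_K n Q R
        gcongr),
      fun Q h1 h2 h3 => (h.2.2 Q h1 h2 h3).trans hAA'⟩
  refine ⟨C + 2 * β, by positivity, fun μ hg i hi f A hf hA h => ?_⟩
  have hCA : 0 ≤ C * A := by positivity
  have hβA : A ≤ β * A := le_mul_of_one_le_left hA hβ1
  cases i with
  | one =>
    exact hmono (by linarith) (Bound1.bound4 hn hC₀ hη hα hβ' (hi (by simp)) hg hA h)
  | two => exact hmono (by linarith) (h₂ μ hg f A hf hA h)
  | three =>
    exact hmono (by linarith) (Bound3.bound4 hn hη hα hβ' (hi (by simp)) hg hA h)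
  | four => exact hmono (by linarith) (h : Bound4 μ n α β f A)

/-! ### Absolute values -/

theorem Cube.integral_abs_abs_sub_le [IsLocallyFiniteMeasure μ] {f : (Fin d → ℝ) → ℝ}
    (hf : LocallyIntegrable f μ) (Q : Cube μ) (c : ℝ) :
    ∫ x in Q.toSet, abs (|f x| - |c|) ∂μ ≤ ∫ x in Q.toSet, |f x - c| ∂μ :=
  integral_mono (Q.integrableOn_sub_const hf.abs _) (Q.integrableOn_sub_const hf c)
    fun _ => abs_abs_sub_abs_le_abs_sub _ _

/-- Integrates ||f| - |c|| ≤ |f - c| with c = m_Q f, so that differences of means of |f| reduce to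
those of f. -/
theorem Cube.abs_mean_abs_sub_le [IsLocallyFiniteMeasure μ] {f : (Fin d → ℝ) → ℝ}
    (hf : LocallyIntegrable f μ) (Q : Cube μ) :
    abs (mean μ (fun x => |f x|) Q.toSet - |mean μ f Q.toSet|) ≤
      (μ.real Q.toSet)⁻¹ * ∫ x in Q.toSet, |f x - mean μ f Q.toSet| ∂μ := by
  exact (Q.abs_mean_sub_le hf.abs _).trans (mul_le_mul_of_nonneg_left
    (Q.integral_abs_abs_sub_le hf _) (inv_nonneg.2 measureReal_nonneg))

theorem Cube.abs_mean_abs_sub_le_two_mul [IsLocallyFiniteMeasure μ] {f : (Fin d → ℝ) → ℝ}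
    (hf : LocallyIntegrable f μ) (Q : Cube μ) :
    abs (mean μ (fun x => |f x|) Q.toSet - |mean μ f Q.toSet|) ≤
      2 * ((μ.real Q.toSet)⁻¹ * ∫ x in Q.toSet, |f x| ∂μ) := by
  have h1 := Q.abs_mean_le hf
  have h2 := abs_sub (mean μ (fun x => |f x|) Q.toSet) (|mean μ f Q.toSet|)
  have h3 := Q.abs_mean_le hf.abs
  simp only [abs_abs] at h2 h3
  linarith

theorem abs_sub_le_of_abs_abs_sub_le {a b a' b' x y z : ℝ} (h1 : abs (a' - |a|) ≤ x)
    (h2 : abs (b' - |b|) ≤ y) (h3 : |a - b| ≤ z) : |a' - b'| ≤ x + y + z := by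
  have h4 := (abs_abs_sub_abs_le_abs_sub a b).trans h3
  rw [abs_le] at *
  constructor <;> linarith [h1.1, h1.2, h2.1, h2.2, h4.1, h4.2]

theorem Bound4.abs_mean_abs_sub_le [IsLocallyFiniteMeasure μ] {n α β A : ℝ}
    {f : (Fin d → ℝ) → ℝ} (hf : LocallyIntegrable f μ) (hA : 0 ≤ A) (h : Bound4 μ n α β f A)
    {Q : Cube μ} (hQd : Q.Doubling α β) (hQe : Q.SmallEx α β) :
    abs (mean μ (fun x => |f x|) Q.toSet - |mean μ f Q.toSet|) ≤ 2 * A := by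
  by_cases hQ : Q.Small
  · linarith [Q.abs_mean_abs_sub_le hf, h.1 Q hQd hQ]
  · linarith [Q.abs_mean_abs_sub_le_two_mul hf, h.2.2 Q hQd hQe hQ]

theorem Bound4.abs [IsLocallyFiniteMeasure μ] {n α β A : ℝ} {f : (Fin d → ℝ) → ℝ} (hα : 1 < α)
    (hf : LocallyIntegrable f μ) (hA : 0 ≤ A) (h : Bound4 μ n α β f A) :
    Bound4 μ n α β (fun x => |f x|) (5 * A) := by
  refine ⟨fun Q hQd hQ => ?_, fun Q R hQR hQd hRd hQ hR => ?_, fun Q hQd hQe hQ => ?_⟩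
  · have h1 := Q.integral_abs_sub_mean_le hf.abs (|mean μ f Q.toSet|)
    have h2 := Q.integral_abs_abs_sub_le hf (mean μ f Q.toSet)
    have h3 := (inv_mul_le_iff_le_mul_real Q.measureReal_toSet_pos).1 (h.1 Q hQd hQ)
    rw [inv_mul_le_iff_le_mul_real Q.measureReal_toSet_pos]
    have h4 : 0 ≤ A * μ.real Q.toSet := by positivity
    linarith
  · have hK := one_le_K n Q R
    refine (abs_sub_le_of_abs_abs_sub_le (h.abs_mean_abs_sub_le hf hA hQd (hQ.smallEx hα))
      (h.abs_mean_abs_sub_le hf hA hRd hR) (h.2.1 Q R hQR hQd hRd hQ hR)).trans ?_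
    have : A * 1 ≤ A * Q.K n R := by gcongr
    linarith
  · simp only [abs_abs]
    linarith [h.2.2 Q hQd hQe hQ]

theorem Bound1.abs {n C₀ η α β A : ℝ} {f : (Fin d → ℝ) → ℝ} (hn : 0 < n) (hC₀ : 0 < C₀)
    (hη : 1 < η) (hα : 1 < α) (hβ : α ^ n < β) (hηα : η ≤ α) (hg : Growth μ n C₀) (hA : 0 ≤ A)
    (hf : LocallyIntegrable f μ) (h : Bound1 μ n η α β f A) :
    Bound1 μ n η α β (fun x => |f x|) ((1 + 4 * β) * A) := by
  have := hg.isLocallyFiniteMeasure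
  have h4 := h.bound4 hn hC₀ hη hα hβ hηα hg hA
  have hβ1 : 1 ≤ β := (Real.one_lt_rpow hα hn).le.trans hβ.le
  have hβA : 0 ≤ β * A := by positivity
  refine ⟨fun Q hQ => ?_, fun Q R hQR hQd hRd hQ hR => ?_, fun Q hQe hQ => ?_⟩
  -- Q~ is doubling and in 𝒬_ex, so the fourth condition lets m_{Q~}|f| be exchanged for |m_{Q~} f|.
  · obtain ⟨M, -, ht⟩ := exists_tilde n C₀ α β hn hC₀ hα hβ
    obtain ⟨R, -, -, hRt, hRd, -, hRs, -⟩ := ht μ hg Q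
    have h1 := (inv_mul_le_iff_le_mul_real (Q.measureReal_dil_pos (by linarith))).1 (h.1 Q hQ)
    rw [inv_mul_le_iff_le_mul_real (Q.measureReal_dil_pos (by linarith))]
    rw [← hRt] at h1 ⊢
    have h2 := Q.integral_abs_sub_le hf.abs (|mean μ f R.toSet|) (mean μ (fun x => |f x|) R.toSet)
    have h3 := Q.integral_abs_abs_sub_le hf (mean μ f R.toSet)
    have h5 := h4.abs_mean_abs_sub_le hf hβA hRd (hRs hQ)
    rw [abs_sub_comm] at h5
    have h6 := mul_le_mul h5 (Q.measureReal_toSet_le_dil hη.le) measureReal_nonneg (by positivity)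
    have h7 : 0 ≤ β * A * μ.real (Q.dil η) := by positivity
    linarith
  · have hK := one_le_K n Q R
    refine (abs_sub_le_of_abs_abs_sub_le (h4.abs_mean_abs_sub_le hf hβA hQd (hQ.smallEx hα))
      (h4.abs_mean_abs_sub_le hf hβA hRd hR) (h.2.1 Q R hQR hQd hRd hQ hR)).trans ?_
    have : β * A * 1 ≤ β * A * Q.K n R := by gcongr
    linarith
  · simp only [abs_abs]
    linarith [h.2.2 Q hQe hQ]

theorem Bound2.abs [IsLocallyFiniteMeasure μ] {n η α β A : ℝ} {f : (Fin d → ℝ) → ℝ}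
    (hf : LocallyIntegrable f μ) (h : Bound2 μ n η α β f A) :
    Bound2 μ n η α β (fun x => |f x|) A := by
  obtain ⟨F, h1, h2, h3⟩ := h
  refine ⟨fun Q => |F Q|, fun Q hQ => le_trans ?_ (h1 Q hQ), fun Q R hQR hQ hR =>
    (abs_abs_sub_abs_le_abs_sub _ _).trans (h2 Q R hQR hQ hR), fun R hR hR' => ?_⟩
  · exact mul_le_mul_of_nonneg_left (Q.integral_abs_abs_sub_le hf _)
      (inv_nonneg.2 measureReal_nonneg)
  · simpa using h3 R hR hR'

theorem Bound3.abs [IsLocallyFiniteMeasure μ] {n η α β A : ℝ} {f : (Fin d → ℝ) → ℝ}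
    (hη : 1 < η) (hα : 1 < α) (hA : 0 ≤ A) (hf : LocallyIntegrable f μ)
    (h : Bound3 μ n η α β f A) : Bound3 μ n η α β (fun x => |f x|) (3 * A) := by
  have hη0 : 0 < η := by linarith
  -- Here Q need not be doubling; dividing by μ(Q) in place of μ(ηQ) costs exactly the ratio allowed
  -- in the third space.
  have hm : ∀ Q : Cube μ, Q.SmallEx α β →
      _root_.abs (mean μ (fun x => |f x|) Q.toSet - |mean μ f Q.toSet|) ≤
        2 * A * (μ.real (Q.dil η) / μ.real Q.toSet) := by
    intro Q hQe
    have hpos := Q.measureReal_toSet_pos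
    have hnn : 0 ≤ A * (μ.real (Q.dil η) / μ.real Q.toSet) := by positivity
    have hconv : ∀ I : ℝ, (μ.real (Q.dil η))⁻¹ * I ≤ A →
        (μ.real Q.toSet)⁻¹ * I ≤ A * (μ.real (Q.dil η) / μ.real Q.toSet) := by
      intro I hI
      rw [inv_mul_le_iff_le_mul_real (Q.measureReal_dil_pos hη0)] at hI
      rw [inv_mul_le_iff_le_mul_real hpos, mul_assoc, div_mul_cancel₀ _ hpos.ne']
      exact hI
    by_cases hQ : Q.Small
    · linarith [Q.abs_mean_abs_sub_le hf, hconv _ (h.1 Q hQ)]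
    · linarith [Q.abs_mean_abs_sub_le_two_mul hf, hconv _ (h.2.2 Q hQe hQ)]
  refine ⟨fun Q hQ => ?_, fun Q R hQR hQ hR => ?_, fun Q hQe hQ => ?_⟩
  · have h1 := Q.integral_abs_sub_mean_le hf.abs (|mean μ f Q.toSet|)
    have h2 := Q.integral_abs_abs_sub_le hf (mean μ f Q.toSet)
    have h3 := (inv_mul_le_iff_le_mul_real (Q.measureReal_dil_pos hη0)).1 (h.1 Q hQ)
    rw [inv_mul_le_iff_le_mul_real (Q.measureReal_dil_pos hη0)]
    have h4 : 0 ≤ A * μ.real (Q.dil η) := by positivity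
    linarith
  · have hK := one_le_K n Q R
    refine (abs_sub_le_of_abs_abs_sub_le (hm Q (hQ.smallEx hα)) (hm R hR)
      (h.2.1 Q R hQR hQ hR)).trans ?_
    set w := μ.real (Q.dil η) / μ.real Q.toSet + μ.real (R.dil η) / μ.real R.toSet with hw
    have hw0 : 0 ≤ w := by positivity
    have : A * 1 * w ≤ A * Q.K n R * w := by gcongr
    have e : A * w = A * (μ.real (Q.dil η) / μ.real Q.toSet) +
      A * (μ.real (R.dil η) / μ.real R.toSet) := by rw [hw]; ring
    linarith
  · simp only [abs_abs]
    linarith [h.2.2 Q hQe hQ]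

/-! ### Bounded functions -/

theorem integral_abs_le_of_ae_le [IsLocallyFiniteMeasure μ] {f : (Fin d → ℝ) → ℝ} {B : ℝ}
    (hB : ∀ᵐ x ∂μ, |f x| ≤ B) (x : Fin d → ℝ) (r : ℝ) :
    ∫ z in Metric.closedBall x r, |f z| ∂μ ≤ B * μ.real (Metric.closedBall x r) := by
  have h := norm_setIntegral_le_of_norm_le_const_ae' (μ := μ) (f := fun z => |f z|) (C := B)
    (s := Metric.closedBall x r) measure_closedBall_lt_top ?_
  · exact (le_abs_self _).trans h
  · filter_upwards [hB] with z hz _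
    simpa using hz

theorem abs_mean_le_of_ae_le [IsLocallyFiniteMeasure μ] {f : (Fin d → ℝ) → ℝ} {B : ℝ}
    (hB0 : 0 ≤ B) (hB : ∀ᵐ x ∂μ, |f x| ≤ B) (x : Fin d → ℝ) (r : ℝ) :
    |mean μ f (Metric.closedBall x r)| ≤ B := by
  unfold mean
  rw [abs_mul, abs_inv, abs_of_nonneg measureReal_nonneg]
  have h1 : |∫ z in Metric.closedBall x r, f z ∂μ| ≤ B * μ.real (Metric.closedBall x r) :=
    abs_integral_le_integral_abs.trans (integral_abs_le_of_ae_le hB x r)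
  calc _ ≤ (μ.real (Metric.closedBall x r))⁻¹ * (B * μ.real (Metric.closedBall x r)) := by gcongr
    _ = B * ((μ.real (Metric.closedBall x r))⁻¹ * μ.real (Metric.closedBall x r)) := by ring
    _ ≤ B * 1 := by gcongr; exact inv_mul_le_one
    _ = B := mul_one B

theorem bound_of_ae_le [IsLocallyFiniteMeasure μ] {n η α β B : ℝ} {f : (Fin d → ℝ) → ℝ}
    (hη : 1 < η) (hf : LocallyIntegrable f μ) (hB0 : 0 ≤ B) (hB : ∀ᵐ x ∂μ, |f x| ≤ B)
    (i : Index) : Bound i μ n η α β f (2 * B) := by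
  have hη0 : 0 < η := by linarith
  have hosc : ∀ (Q : Cube μ) (c : ℝ), |c| ≤ B →
      ∫ x in Q.toSet, |f x - c| ∂μ ≤ 2 * B * μ.real Q.toSet := by
    intro Q c hc
    have h1 := Q.integral_abs_sub_le_abs hf c
    have h2 : ∫ z in Q.toSet, |f z| ∂μ ≤ B * μ.real Q.toSet := integral_abs_le_of_ae_le hB _ _
    have h3 := mul_le_mul_of_nonneg_right hc Q.measureReal_toSet_pos.le
    linarith
  have hoscη : ∀ (Q : Cube μ) (c : ℝ), |c| ≤ B →
      (μ.real (Q.dil η))⁻¹ * ∫ x in Q.toSet, |f x - c| ∂μ ≤ 2 * B := by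
    intro Q c hc
    rw [inv_mul_le_iff_le_mul_real (Q.measureReal_dil_pos hη0)]
    exact (hosc Q c hc).trans (mul_le_mul_of_nonneg_left (Q.measureReal_toSet_le_dil hη.le)
      (by positivity))
  have hm : ∀ Q : Cube μ, |mean μ f Q.toSet| ≤ B := fun Q => abs_mean_le_of_ae_le hB0 hB _ _
  have hmm : ∀ Q R : Cube μ, |mean μ f Q.toSet - mean μ f R.toSet| ≤ 2 * B * Q.K n R := by
    intro Q R
    have h1 := abs_sub (mean μ f Q.toSet) (mean μ f R.toSet)
    have h2 := hm Q
    have h3 := hm R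
    have hK := one_le_K n Q R
    have h4 : 2 * B * 1 ≤ 2 * B * Q.K n R := by gcongr
    linarith
  cases i with
  | one =>
    refine ⟨fun Q _ => hoscη Q _ (abs_mean_le_of_ae_le hB0 hB _ _), fun Q R _ _ _ _ _ => hmm Q R,
      fun Q _ _ => ?_⟩
    simpa using hoscη Q 0 (by simpa using hB0)
  | two =>
    refine ⟨fun _ => 0, fun Q _ => hoscη Q 0 (by simpa using hB0), fun Q R _ _ _ => ?_,
      fun R _ _ => by simpa using hB0⟩
    have hK := one_le_K n Q R
    simp only [sub_self, abs_zero]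
    positivity
  | three =>
    refine ⟨fun Q _ => hoscη Q _ (hm Q), fun Q R _ _ _ => ?_, fun Q _ _ => ?_⟩
    · have hK := one_le_K n Q R
      refine (hmm Q R).trans (le_mul_of_one_le_right (by positivity) ?_)
      have h1 : 1 ≤ μ.real (Q.dil η) / μ.real Q.toSet :=
        (one_le_div Q.measureReal_toSet_pos).2 (Q.measureReal_toSet_le_dil hη.le)
      have h2 : 0 ≤ μ.real (R.dil η) / μ.real R.toSet := by positivity
      linarith
    · simpa using hoscη Q 0 (by simpa using hB0)
  | four =>
    refine ⟨fun Q _ _ => ?_, fun Q R _ _ _ _ _ => hmm Q R, fun Q _ _ _ => ?_⟩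
    · exact (inv_mul_le_iff_le_mul_real Q.measureReal_toSet_pos).2 (hosc Q _ (hm Q))
    · rw [inv_mul_le_iff_le_mul_real Q.measureReal_toSet_pos]
      simpa using hosc Q 0 (by simpa using hB0)

theorem bound_of_memLp_top [IsLocallyFiniteMeasure μ] {n η α β : ℝ} {f : (Fin d → ℝ) → ℝ}
    (hη : 1 < η) (hf : MemLp f ⊤ μ) (i : Index) :
    LocallyIntegrable f μ ∧ Bound i μ n η α β f (2 * (eLpNorm f ⊤ μ).toReal) := by
  have hloc := hf.locallyIntegrable le_top
  refine ⟨hloc, bound_of_ae_le hη hloc ENNReal.toReal_nonneg ?_ i⟩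
  rw [eLpNorm_exponent_top]
  filter_upwards [ae_le_eLpNormEssSup (f := f) (μ := μ)] with x hx
  have h1 := hf.2
  rw [eLpNorm_exponent_top] at h1
  have := ENNReal.toReal_mono h1.ne hx
  simpa using this

/-! ### Complete seminorms -/

/-- Every absolutely convergent series converges. -/
def SeriesComplete {E : Type} [AddCommGroup E] [Module ℝ E] (p : Seminorm ℝ E) : Prop :=
  ∀ g : ℕ → E, Summable (fun k => p (g k)) →
    ∃ f : E, Filter.Tendsto (fun N => p (f - ∑ k ∈ Finset.range N, g k)) Filter.atTop (nhds 0)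

/-- X is the separation quotient; a series in it lifts term by term with the same norms. -/
theorem SeriesComplete.exists_banach {E : Type} [AddCommGroup E] [Module ℝ E] {p : Seminorm ℝ E}
    (hp : SeriesComplete p) :
    ∃ (X : Type) (_ : NormedAddCommGroup X) (_ : NormedSpace ℝ X) (_ : CompleteSpace X)
      (T : E →ₗ[ℝ] X), Function.Surjective T ∧ ∀ f : E, ‖T f‖ = p f := by
  let _ : SeminormedAddCommGroup E := p.toAddGroupSeminorm.toSeminormedAddCommGroup
  let _ : NormedSpace ℝ E := ⟨fun r x => (map_smul_eq_mul p r x).le⟩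
  have hnorm : ∀ f : E, ‖f‖ = p f := fun f => rfl
  refine ⟨SeparationQuotient E, inferInstance, inferInstance, ?_,
    (SeparationQuotient.mkCLM ℝ E : E →ₗ[ℝ] SeparationQuotient E),
    SeparationQuotient.surjective_mk, fun f => SeparationQuotient.norm_mk f⟩
  refine NormedAddCommGroup.completeSpace_of_summable_imp_tendsto fun u hu => ?_
  choose g hg using fun k => SeparationQuotient.surjective_mk (u k)
  have hu' : Summable fun k => p (g k) := by
    refine hu.congr fun k => ?_
    rw [← hg k, SeparationQuotient.norm_mk, hnorm]
  obtain ⟨f, hf⟩ := hp g hu'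
  refine ⟨SeparationQuotient.mk f, ?_⟩
  rw [tendsto_iff_norm_sub_tendsto_zero]
  refine hf.congr fun N => ?_
  have h1 : ∑ k ∈ Finset.range N, u k =
      SeparationQuotient.mkCLM ℝ E (∑ k ∈ Finset.range N, g k) := by
    rw [map_sum]
    exact Finset.sum_congr rfl fun k _ => (hg k).symm
  rw [h1, ← hnorm, norm_sub_rev, ← SeparationQuotient.norm_mk]
  rfl

theorem isBanachModulo_of_seminorm {mem : ((Fin d → ℝ) → ℝ) → Prop}
    {nrm : ((Fin d → ℝ) → ℝ) → ℝ} {null : ((Fin d → ℝ) → ℝ) → Prop}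
    (V : Submodule ℝ ((Fin d → ℝ) → ℝ)) (hV : ∀ f, f ∈ V ↔ mem f) (p : Seminorm ℝ V)
    (hp : ∀ f : V, p f = nrm f) (hnull : ∀ f : V, p f = 0 ↔ null f) (hc : SeriesComplete p) :
    IsBanachModulo mem nrm null := by
  obtain ⟨X, i1, i2, i3, T, hT, hTp⟩ := hc.exists_banach
  refine ⟨V, hV, X, i1, i2, i3, T, hT, fun f => (hTp f).trans (hp f), fun f => ?_⟩
  rw [← norm_eq_zero, hTp, hnull]

/-! ### Quotient of a seminorm by a line -/

section quotient

variable {E : Type} [AddCommGroup E] [Module ℝ E]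

theorem bddBelow_range_sub_smul (p : Seminorm ℝ E) (e f : E) :
    BddBelow (Set.range fun c : ℝ => p (f - c • e)) :=
  ⟨0, by rintro _ ⟨c, rfl⟩; exact apply_nonneg p _⟩

/-- The quotient seminorm modulo the line spanned by `e`. -/
def quotSeminorm (p : Seminorm ℝ E) (e : E) : Seminorm ℝ E :=
  Seminorm.ofSMulLE (fun f => ⨅ c : ℝ, p (f - c • e))
    (le_antisymm ((ciInf_le (bddBelow_range_sub_smul p e 0) 0).trans (by simp))
      (le_ciInf fun c => apply_nonneg p _))
    (fun f g => by
      refine le_of_forall_pos_le_add fun ε hε => ?_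
      obtain ⟨a, ha⟩ := exists_lt_of_ciInf_lt
        (lt_add_of_pos_right (⨅ c : ℝ, p (f - c • e)) (half_pos hε))
      obtain ⟨b, hb⟩ := exists_lt_of_ciInf_lt
        (lt_add_of_pos_right (⨅ c : ℝ, p (g - c • e)) (half_pos hε))
      refine (ciInf_le (bddBelow_range_sub_smul p e (f + g)) (a + b)).trans ?_
      have h1 : f + g - (a + b) • e = (f - a • e) + (g - b • e) := by rw [add_smul]; abel
      rw [h1]
      linarith [map_add_le_add p (f - a • e) (g - b • e)])
    (fun r f => by
      rw [Real.mul_iInf_of_nonneg (norm_nonneg r)]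
      refine le_ciInf fun c => (ciInf_le (bddBelow_range_sub_smul p e (r • f)) (r * c)).trans ?_
      rw [mul_smul, ← smul_sub, map_smul_eq_mul])

theorem quotSeminorm_apply (p : Seminorm ℝ E) (e f : E) :
    quotSeminorm p e f = ⨅ c : ℝ, p (f - c • e) := rfl

theorem quotSeminorm_le (p : Seminorm ℝ E) (e f : E) (c : ℝ) :
    quotSeminorm p e f ≤ p (f - c • e) :=
  ciInf_le (bddBelow_range_sub_smul p e f) c

/-- Each term is represented up to an error 2^(-k) by subtracting a multiple of e; the corrected
series is absolutely convergent for p. -/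
theorem SeriesComplete.quotSeminorm {p : Seminorm ℝ E} (hp : SeriesComplete p) (e : E) :
    SeriesComplete (quotSeminorm p e) := by
  intro g hg
  have h1 : ∀ k : ℕ, ∃ c : ℝ, p (g k - c • e) < LocalBMO.quotSeminorm p e (g k) + (1 / 2) ^ k :=
    fun k => exists_lt_of_ciInf_lt (lt_add_of_pos_right _ (by positivity))
  choose c hc using h1
  have hs : Summable fun k => p (g k - c k • e) :=
    Summable.of_nonneg_of_le (fun k => apply_nonneg p _) (fun k => (hc k).le)
      (hg.add (summable_geometric_of_lt_one (by norm_num) (by norm_num)))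
  obtain ⟨f, hf⟩ := hp _ hs
  refine ⟨f, squeeze_zero (fun N => apply_nonneg _ _) (fun N => ?_) hf⟩
  refine (quotSeminorm_le p e _ (-∑ k ∈ Finset.range N, c k)).trans (le_of_eq ?_)
  congr 1
  rw [Finset.sum_sub_distrib, ← Finset.sum_smul, neg_smul]
  abel

/-- The infimum is attained: c ↦ p(f - c e) is constant if p e = 0, and continuous and coercive
otherwise. -/
theorem quotSeminorm_eq_zero_iff (p : Seminorm ℝ E) (e f : E) :
    quotSeminorm p e f = 0 ↔ ∃ c : ℝ, p (f - c • e) = 0 := by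
  constructor
  · intro h
    have hlip : ∀ a b : ℝ, p (f - a • e) - p (f - b • e) ≤ |a - b| * p e := by
      intro a b
      have h1 : f - a • e = (f - b • e) + (b - a) • e := by rw [sub_smul]; abel
      have h2 := map_add_le_add p (f - b • e) ((b - a) • e)
      rw [← h1, map_smul_eq_mul, Real.norm_eq_abs, abs_sub_comm] at h2
      linarith
    rcases (apply_nonneg p e).eq_or_lt with h0 | h0
    · refine ⟨0, le_antisymm ?_ (apply_nonneg p _)⟩
      refine le_trans (le_ciInf fun c => ?_) h.le
      have := hlip 0 c
      rw [← h0, mul_zero] at this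
      linarith
    · have hcont : Continuous fun c : ℝ => p (f - c • e) := by
        refine (LipschitzWith.of_dist_le_mul (K := ⟨p e, h0.le⟩) fun a b => ?_).continuous
        rw [Real.dist_eq, Real.dist_eq, mul_comm]
        exact abs_sub_le_iff.2 ⟨hlip a b, by rw [abs_sub_comm]; exact hlip b a⟩
      have htend : Filter.Tendsto (fun c : ℝ => p (f - c • e)) (Filter.cocompact ℝ)
          Filter.atTop := by
        refine Filter.tendsto_atTop_mono (f := fun c : ℝ => ‖c‖ * p e + -p f) (fun c => ?_)
          (Filter.tendsto_atTop_add_const_right _ _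
            ((tendsto_norm_cocompact_atTop (E := ℝ)).atTop_mul_const h0))
        have h1 := map_sub_le_add p f (f - c • e)
        rw [sub_sub_cancel, map_smul_eq_mul] at h1
        linarith
      obtain ⟨c, hc⟩ := hcont.exists_forall_le htend
      exact ⟨c, le_antisymm (h ▸ le_ciInf hc) (apply_nonneg p _)⟩
  · rintro ⟨c, hc⟩
    exact le_antisymm (hc ▸ quotSeminorm_le p e f c) (apply_nonneg _ _)

end quotient

/-! ### Locally absolutely convergent series of functions -/

/-- The series `∑ g k` converges to `f` almost everywhere, and absolutely in `L¹` of every cube. -/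
structure LocSum (μ : Measure (Fin d → ℝ)) (g : ℕ → (Fin d → ℝ) → ℝ) (f : (Fin d → ℝ) → ℝ) :
    Prop where
  locallyIntegrable : ∀ k, LocallyIntegrable (g k) μ
  summable : ∀ x r, Summable fun k => ∫ z in Metric.closedBall x r, |g k z| ∂μ
  ae_hasSum : ∀ᵐ z ∂μ, HasSum (fun k => g k z) (f z)

namespace LocSum

variable {g : ℕ → (Fin d → ℝ) → ℝ} {f : (Fin d → ℝ) → ℝ}

theorem aestronglyMeasurable (h : LocSum μ g f) (x : Fin d → ℝ) (r : ℝ) :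
    AEStronglyMeasurable f (μ.restrict (Metric.closedBall x r)) := by
  refine aestronglyMeasurable_of_tendsto_ae Filter.atTop
    (f := fun N z => ∑ k ∈ Finset.range N, g k z) (fun N => ?_) ?_
  · exact Finset.aestronglyMeasurable_fun_sum _ fun k _ =>
      ((h.locallyIntegrable k).integrableOn_isCompact (isCompact_closedBall x r)).1
  · filter_upwards [ae_restrict_of_ae h.ae_hasSum] with z hz
    exact hz.tendsto_sum_nat

/-- The countable triangle inequality under the integral, stated for the lower integral because f is
not yet known to be integrable. -/
theorem lintegral_enorm_sub_le [IsLocallyFiniteMeasure μ] (h : LocSum μ g f) {x : Fin d → ℝ}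
    {r : ℝ} {c : ℕ → ℝ} {c' : ℝ} (hc : HasSum c c') {a : ℕ → ℝ} (ha : Summable a)
    (hle : ∀ k, ∫ z in Metric.closedBall x r, |g k z - c k| ∂μ ≤ a k) :
    ∫⁻ z in Metric.closedBall x r, ‖f z - c'‖ₑ ∂μ ≤ ENNReal.ofReal (∑' k, a k) := by
  have hint : ∀ k, IntegrableOn (fun z => g k z - c k) (Metric.closedBall x r) μ := fun k =>
    ((h.locallyIntegrable k).integrableOn_isCompact (isCompact_closedBall x r)).sub
      (integrableOn_const measure_closedBall_lt_top.ne)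
  have ha0 : ∀ k, 0 ≤ a k := fun k => (integral_nonneg fun _ => abs_nonneg _).trans (hle k)
  calc ∫⁻ z in Metric.closedBall x r, ‖f z - c'‖ₑ ∂μ
      ≤ ∫⁻ z in Metric.closedBall x r, ∑' k, ‖g k z - c k‖ₑ ∂μ := by
        refine lintegral_mono_ae ?_
        filter_upwards [ae_restrict_of_ae h.ae_hasSum] with z hz
        rw [← (hz.sub hc).tsum_eq]
        exact enorm_tsum_le_tsum_enorm
    _ = ∑' k, ∫⁻ z in Metric.closedBall x r, ‖g k z - c k‖ₑ ∂μ :=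
        lintegral_tsum fun k => (hint k).1.enorm
    _ ≤ ∑' k, ENNReal.ofReal (a k) := by
        refine ENNReal.tsum_le_tsum fun k => ?_
        rw [← ofReal_integral_norm_eq_lintegral_enorm (hint k)]
        exact ENNReal.ofReal_le_ofReal (hle k)
    _ = ENNReal.ofReal (∑' k, a k) := (ENNReal.ofReal_tsum_of_nonneg ha0 ha).symm

theorem integral_abs_sub_le [IsLocallyFiniteMeasure μ] (h : LocSum μ g f) {x : Fin d → ℝ}
    {r : ℝ} {c : ℕ → ℝ} {c' : ℝ} (hc : HasSum c c') {a : ℕ → ℝ} {a' : ℝ} (ha : HasSum a a')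
    (hle : ∀ k, ∫ z in Metric.closedBall x r, |g k z - c k| ∂μ ≤ a k) :
    ∫ z in Metric.closedBall x r, |f z - c'| ∂μ ≤ a' := by
  have h1 := h.lintegral_enorm_sub_le hc ha.summable hle
  have h2 := integral_norm_eq_lintegral_enorm (μ := μ.restrict (Metric.closedBall x r))
    (f := fun z => f z - c') ((h.aestronglyMeasurable x r).sub aestronglyMeasurable_const)
  rw [ha.tsum_eq] at h1
  have ha0 : 0 ≤ a' :=
    ha.nonneg fun k => (integral_nonneg fun _ => abs_nonneg _).trans (hle k)
  refine (le_of_eq h2).trans (ENNReal.toReal_le_of_le_ofReal ha0 h1)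

theorem locallyIntegrable_sum [IsLocallyFiniteMeasure μ] (h : LocSum μ g f) :
    LocallyIntegrable f μ := by
  intro x
  refine ⟨Metric.closedBall x 1, Metric.closedBall_mem_nhds x one_pos,
    h.aestronglyMeasurable x 1, ?_⟩
  have h1 := h.lintegral_enorm_sub_le (c := fun _ => 0) (c' := 0) hasSum_zero (h.summable x 1)
    (x := x) (r := 1) (fun k => by simp)
  simp only [sub_zero] at h1
  exact h1.trans_lt ENNReal.ofReal_lt_top

theorem hasSum_mean (h : LocSum μ g f) (x : Fin d → ℝ) (r : ℝ) :
    HasSum (fun k => mean μ (g k) (Metric.closedBall x r)) (mean μ f (Metric.closedBall x r)) := by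
  have h1 := hasSum_integral_of_summable_integral_norm
    (μ := μ.restrict (Metric.closedBall x r)) (F := g)
    (fun k => (h.locallyIntegrable k).integrableOn_isCompact (isCompact_closedBall x r))
    (h.summable x r)
  have h2 : ∫ z in Metric.closedBall x r, (∑' k, g k z) ∂μ =
      ∫ z in Metric.closedBall x r, f z ∂μ := by
    refine integral_congr_ae ?_
    filter_upwards [ae_restrict_of_ae h.ae_hasSum] with z hz
    exact hz.tsum_eq
  rw [h2] at h1
  exact h1.mul_left _

theorem tail (h : LocSum μ g f) (N : ℕ) :
    LocSum μ (fun k => g (k + N)) (f - ∑ k ∈ Finset.range N, g k) where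
  locallyIntegrable k := h.locallyIntegrable _
  summable x r := (summable_nat_add_iff N).2 (h.summable x r)
  ae_hasSum := by
    filter_upwards [h.ae_hasSum] with z hz
    have := (hasSum_nat_add_iff' N).2 hz
    simpa using this

end LocSum

/-- By Tonelli, ∑ |g k| has finite integral over every ball, hence is finite almost everywhere;
countably many balls exhaust the space. -/
theorem exists_locSum [IsLocallyFiniteMeasure μ] {g : ℕ → (Fin d → ℝ) → ℝ}
    (hg : ∀ k, LocallyIntegrable (g k) μ)
    (hs : ∀ x r, Summable fun k => ∫ z in Metric.closedBall x r, |g k z| ∂μ) :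
    LocSum μ g (fun z => ∑' k, g k z) := by
  refine ⟨hg, hs, ?_⟩
  have hball : ∀ N : ℕ, ∀ᵐ z ∂(μ.restrict (Metric.closedBall 0 N)), Summable fun k => g k z := by
    intro N
    have hint : ∀ k, IntegrableOn (g k) (Metric.closedBall 0 N) μ := fun k =>
      (hg k).integrableOn_isCompact (isCompact_closedBall 0 N)
    have h1 : ∫⁻ z in Metric.closedBall 0 N, ∑' k, ‖g k z‖ₑ ∂μ ≠ ⊤ := by
      rw [lintegral_tsum fun k => (hint k).1.enorm]
      have h2 : ∀ k, ∫⁻ z in Metric.closedBall 0 N, ‖g k z‖ₑ ∂μ =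
          ENNReal.ofReal (∫ z in Metric.closedBall 0 N, |g k z| ∂μ) := fun k =>
        (ofReal_integral_norm_eq_lintegral_enorm (hint k)).symm
      simp_rw [h2]
      rw [← ENNReal.ofReal_tsum_of_nonneg (fun k => integral_nonneg fun _ => abs_nonneg _)
        (hs 0 N)]
      exact ENNReal.ofReal_ne_top
    filter_upwards [ae_lt_top' (AEMeasurable.tsum fun k => (hint k).1.enorm) h1]
      with z hz
    exact (tsum_enorm_ne_top_iff_summable_norm.1 hz.ne).of_norm
  have h3 := (ae_restrict_iUnion_iff (fun N : ℕ => Metric.closedBall (0 : Fin d → ℝ) N)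
    (fun z => Summable fun k => g k z)).2 hball
  rw [Metric.iUnion_closedBall_nat, Measure.restrict_univ] at h3
  filter_upwards [h3] with z hz
  exact hz.hasSum

/-- The sequence `a, b, 0, 0, …`. -/
def pairSeq {E : Type*} [Zero E] (a b : E) : ℕ → E
  | 0 => a
  | 1 => b
  | _ => 0

theorem hasSum_pairSeq {E : Type*} [AddCommMonoid E] [TopologicalSpace E] (a b : E) :
    HasSum (pairSeq a b) (a + b) := by
  have h : HasSum (pairSeq a b) (∑ k ∈ Finset.range 2, pairSeq a b k) :=
    hasSum_sum_of_ne_finset_zero ?_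
  · simpa [Finset.sum_range_succ, pairSeq] using h
  · intro k hk
    match k with
    | 0 => simp at hk
    | 1 => simp at hk
    | k + 2 => rfl

/-- Makes the triangle inequality for two functions a special case of countable subadditivity. -/
theorem locSum_pairSeq {f g : (Fin d → ℝ) → ℝ} (hf : LocallyIntegrable f μ)
    (hg : LocallyIntegrable g μ) : LocSum μ (pairSeq f g) (f + g) where
  locallyIntegrable k := by
    match k with
    | 0 => exact hf
    | 1 => exact hg
    | k + 2 => exact locallyIntegrable_zero
  summable x r := by
    refine (hasSum_pairSeq (∫ z in Metric.closedBall x r, |f z| ∂μ)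
      (∫ z in Metric.closedBall x r, |g z| ∂μ)).summable.congr fun k => ?_
    match k with
    | 0 => rfl
    | 1 => rfl
    | k + 2 => simp [pairSeq]
  ae_hasSum := by
    refine Filter.Eventually.of_forall fun z => ?_
    refine (hasSum_pairSeq (f z) (g z)).congr_fun fun k => ?_
    match k with
    | 0 => rfl
    | 1 => rfl
    | k + 2 => rfl

/-! ### Countable subadditivity and homogeneity -/

theorem abs_le_of_hasSum {u a : ℕ → ℝ} {s a' : ℝ} (hu : HasSum u s) (ha : HasSum a a')
    (h : ∀ k, |u k| ≤ a k) : |s| ≤ a' := by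
  rw [← hu.tsum_eq]
  exact tsum_of_norm_bounded (f := u) ha h

namespace LocSum

variable {g : ℕ → (Fin d → ℝ) → ℝ} {f : (Fin d → ℝ) → ℝ}

theorem scaled_integral_abs_sub_le [IsLocallyFiniteMeasure μ] (h : LocSum μ g f) (Q : Cube μ)
    {m : ℝ} (hm : 0 < m) {c A : ℕ → ℝ} {c' A' : ℝ} (hc : HasSum c c') (hA : HasSum A A')
    (hle : ∀ k, m⁻¹ * ∫ z in Q.toSet, |g k z - c k| ∂μ ≤ A k) :
    m⁻¹ * ∫ z in Q.toSet, |f z - c'| ∂μ ≤ A' := by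
  rw [inv_mul_le_iff_le_mul_real hm]
  exact h.integral_abs_sub_le hc (hA.mul_right m) fun k =>
    (inv_mul_le_iff_le_mul_real hm).1 (hle k)

theorem scaled_integral_abs_le [IsLocallyFiniteMeasure μ] (h : LocSum μ g f) (Q : Cube μ)
    {m : ℝ} (hm : 0 < m) {A : ℕ → ℝ} {A' : ℝ} (hA : HasSum A A')
    (hle : ∀ k, m⁻¹ * ∫ z in Q.toSet, |g k z| ∂μ ≤ A k) :
    m⁻¹ * ∫ z in Q.toSet, |f z| ∂μ ≤ A' := by
  have := h.scaled_integral_abs_sub_le Q hm (c := fun _ => 0) (c' := 0) hasSum_zero hA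
    (by simpa using hle)
  simpa using this

theorem hasSum_mean_sub (h : LocSum μ g f) (Q R : Cube μ) :
    HasSum (fun k => mean μ (g k) Q.toSet - mean μ (g k) R.toSet)
      (mean μ f Q.toSet - mean μ f R.toSet) :=
  (h.hasSum_mean _ _).sub (h.hasSum_mean _ _)

/-- Means sum termwise, and each condition bounds an oscillation or a difference that is countably
subadditive. In the second space the families F k are summed as well. -/
theorem bound {n C₀ η α β : ℝ} (h : LocSum μ g f) (hC₀ : 0 < C₀) (hη : 1 < η) (hα : 1 < α)
    (hg : Growth μ n C₀) {i : Index} {A : ℕ → ℝ} {A' : ℝ} (hA : HasSum A A')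
    (hA0 : ∀ k, 0 ≤ A k) (hB : ∀ k, Bound i μ n η α β (g k) (A k)) :
    Bound i μ n η α β f A' := by
  have := hg.isLocallyFiniteMeasure
  have hη0 : 0 < η := by linarith
  cases i with
  | one =>
    refine ⟨fun Q hQ => ?_, fun Q R hQR hQd hRd hQ hR => ?_, fun Q hQe hQ => ?_⟩
    · exact h.scaled_integral_abs_sub_le Q (Q.measureReal_dil_pos hη0) (h.hasSum_mean _ _) hA
        fun k => (hB k).1 Q hQ
    · exact abs_le_of_hasSum (h.hasSum_mean_sub Q R) (hA.mul_right _)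
        fun k => (hB k).2.1 Q R hQR hQd hRd hQ hR
    · exact h.scaled_integral_abs_le Q (Q.measureReal_dil_pos hη0) hA fun k => (hB k).2.2 Q hQe hQ
  | two =>
    choose F hF1 hF2 hF3 using hB
    -- Convergence matters only on 𝒬_ex: no condition involves the other cubes, where the sum may
    -- take a default value. The bound may depend on l(Q), since only summability is wanted.
    have hsum : ∀ Q : Cube μ, Q.SmallEx α β → Summable fun k => F k Q := by
      intro Q hQe
      by_cases hQ : Q.Small
      · obtain ⟨C, hC, h1⟩ := exists_abs_le_of_bound2 n C₀ α β hC₀ hα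
        obtain ⟨M, hM, h2⟩ := exists_dyadicSumLE_ratio n C₀ hC₀ Q.side⁻¹
        refine Summable.of_norm_bounded (hA.summable.mul_left (C + M)) fun k => ?_
        exact h1 μ hg (F k) (A k) (hA0 k) (hF2 k) (hF3 k) Q M hQ
          (h2 μ hg _ _ _ Q.side_pos (inv_mul_cancel₀ Q.side_pos.ne').ge)
      · exact Summable.of_norm_bounded hA.summable fun k => hF3 k Q hQe hQ
    refine ⟨fun Q => ∑' k, F k Q, fun Q hQ => ?_, fun Q R hQR hQ hR => ?_, fun R hR hR' => ?_⟩
    · exact h.scaled_integral_abs_sub_le Q (Q.measureReal_dil_pos hη0)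
        (hsum Q (hQ.smallEx hα)).hasSum hA fun k => hF1 k Q hQ
    · exact abs_le_of_hasSum ((hsum Q (hQ.smallEx hα)).hasSum.sub (hsum R hR).hasSum)
        (hA.mul_right _) fun k => hF2 k Q R hQR hQ hR
    · exact abs_le_of_hasSum (hsum R hR).hasSum hA fun k => hF3 k R hR hR'
  | three =>
    refine ⟨fun Q hQ => ?_, fun Q R hQR hQ hR => ?_, fun Q hQe hQ => ?_⟩
    · exact h.scaled_integral_abs_sub_le Q (Q.measureReal_dil_pos hη0) (h.hasSum_mean _ _) hA
        fun k => (hB k).1 Q hQ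
    · exact abs_le_of_hasSum (h.hasSum_mean_sub Q R) ((hA.mul_right _).mul_right _)
        fun k => (hB k).2.1 Q R hQR hQ hR
    · exact h.scaled_integral_abs_le Q (Q.measureReal_dil_pos hη0) hA fun k => (hB k).2.2 Q hQe hQ
  | four =>
    refine ⟨fun Q hQd hQ => ?_, fun Q R hQR hQd hRd hQ hR => ?_, fun Q hQd hQe hQ => ?_⟩
    · exact h.scaled_integral_abs_sub_le Q Q.measureReal_toSet_pos (h.hasSum_mean _ _) hA
        fun k => (hB k).1 Q hQd hQ
    · exact abs_le_of_hasSum (h.hasSum_mean_sub Q R) (hA.mul_right _)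
        fun k => (hB k).2.1 Q R hQR hQd hRd hQ hR
    · exact h.scaled_integral_abs_le Q Q.measureReal_toSet_pos hA fun k => (hB k).2.2 Q hQd hQe hQ

end LocSum

theorem bound_zero [IsLocallyFiniteMeasure μ] {n η α β : ℝ} {f : (Fin d → ℝ) → ℝ} (hη : 1 < η)
    (hloc : LocallyIntegrable f μ) (hf : f =ᵐ[μ] 0) (i : Index) : Bound i μ n η α β f 0 := by
  have := bound_of_ae_le (n := n) (α := α) (β := β) (B := 0) hη hloc le_rfl
    (by filter_upwards [hf] with x hx; simp [hx]) i
  simpa using this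

theorem Bound.add {n C₀ η α β A B : ℝ} {i : Index} {f g : (Fin d → ℝ) → ℝ} (hC₀ : 0 < C₀)
    (hη : 1 < η) (hα : 1 < α) (hgr : Growth μ n C₀) (hf : LocallyIntegrable f μ)
    (hg : LocallyIntegrable g μ) (hA : 0 ≤ A) (hB : 0 ≤ B) (h : Bound i μ n η α β f A)
    (h' : Bound i μ n η α β g B) : Bound i μ n η α β (f + g) (A + B) := by
  have := hgr.isLocallyFiniteMeasure
  refine (locSum_pairSeq hf hg).bound hC₀ hη hα hgr (hasSum_pairSeq A B) (fun k => ?_) fun k => ?_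
  · match k with
    | 0 => exact hA
    | 1 => exact hB
    | k + 2 => exact le_rfl
  · match k with
    | 0 => exact h
    | 1 => exact h'
    | k + 2 => exact bound_zero hη locallyIntegrable_zero (Filter.EventuallyEq.refl _ _) i

theorem mean_smul (c : ℝ) (f : (Fin d → ℝ) → ℝ) (S : Set (Fin d → ℝ)) :
    mean μ (c • f) S = c * mean μ f S := by
  simp only [mean, Pi.smul_apply, smul_eq_mul, integral_const_mul]
  ring

theorem scaled_integral_smul_le {m c A : ℝ} {f : (Fin d → ℝ) → ℝ} {S : Set (Fin d → ℝ)} {b : ℝ}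
    (h : m⁻¹ * ∫ z in S, |f z - b| ∂μ ≤ A) :
    m⁻¹ * ∫ z in S, |(c • f) z - c * b| ∂μ ≤ |c| * A := by
  simp only [Pi.smul_apply, smul_eq_mul, ← mul_sub, abs_mul, integral_const_mul]
  calc _ = |c| * (m⁻¹ * ∫ z in S, |f z - b| ∂μ) := by ring
    _ ≤ _ := by gcongr

theorem Bound.smul {n η α β A : ℝ} {i : Index} {f : (Fin d → ℝ) → ℝ}
    (h : Bound i μ n η α β f A) (c : ℝ) : Bound i μ n η α β (c • f) (|c| * A) := by
  have hsub : ∀ {a b K : ℝ}, |a - b| ≤ A * K → |c * a - c * b| ≤ |c| * A * K := by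
    intro a b K hab
    rw [← mul_sub, abs_mul, mul_assoc]
    gcongr
  have hzero : ∀ {m : ℝ} {S : Set (Fin d → ℝ)}, m⁻¹ * ∫ z in S, |f z| ∂μ ≤ A →
      m⁻¹ * ∫ z in S, |(c • f) z| ∂μ ≤ |c| * A := by
    intro m S h
    simpa using scaled_integral_smul_le (μ := μ) (m := m) (c := c) (f := f) (S := S) (b := 0)
      (by simpa using h)
  cases i with
  | one =>
    refine ⟨fun Q hQ => ?_, fun Q R hQR hQd hRd hQ hR => ?_, fun Q hQe hQ =>
      hzero (h.2.2 Q hQe hQ)⟩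
    · rw [mean_smul]
      exact scaled_integral_smul_le (h.1 Q hQ)
    · rw [mean_smul, mean_smul]
      exact hsub (h.2.1 Q R hQR hQd hRd hQ hR)
  | two =>
    obtain ⟨F, h1, h2, h3⟩ := h
    refine ⟨fun Q => c * F Q, fun Q hQ => scaled_integral_smul_le (h1 Q hQ),
      fun Q R hQR hQ hR => hsub (h2 Q R hQR hQ hR), fun R hR hR' => ?_⟩
    rw [abs_mul]
    exact mul_le_mul_of_nonneg_left (h3 R hR hR') (abs_nonneg c)
  | three =>
    refine ⟨fun Q hQ => ?_, fun Q R hQR hQ hR => ?_, fun Q hQe hQ =>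
      hzero (h.2.2 Q hQe hQ)⟩
    · rw [mean_smul]
      exact scaled_integral_smul_le (h.1 Q hQ)
    · rw [mean_smul, mean_smul]
      have := h.2.1 Q R hQR hQ hR
      rw [mul_assoc] at this ⊢
      exact hsub this
  | four =>
    refine ⟨fun Q hQd hQ => ?_, fun Q R hQR hQd hRd hQ hR => ?_, fun Q hQd hQe hQ =>
      hzero (h.2.2 Q hQd hQe hQ)⟩
    · rw [mean_smul]
      exact scaled_integral_smul_le (h.1 Q hQd hQ)
    · rw [mean_smul, mean_smul]
      exact hsub (h.2.1 Q R hQR hQd hRd hQ hR)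

theorem exists_bound_abs (d : ℕ) (n C₀ η α β : ℝ) (hn : 0 < n) (hnd : n ≤ d)
    (hC₀ : 0 < C₀) (hη : 1 < η) (hα : 1 < α) (hβ : α ^ d < β) :
    ∃ C : ℝ, 0 ≤ C ∧ ∀ (μ : Measure (Fin d → ℝ)), Growth μ n C₀ → ∀ i : Index,
      (i ≠ Index.two → η ≤ α) →
      ∀ (f : (Fin d → ℝ) → ℝ) (A : ℝ), LocallyIntegrable f μ → 0 ≤ A →
        Bound i μ n η α β f A → ∃ A' ≤ C * A, 0 ≤ A' ∧ Bound i μ n η α β (fun x => |f x|) A' := by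
  have hβ' := rpow_lt_of_pow_lt hnd hα hβ
  have hβ1 : 1 ≤ β := (Real.one_lt_rpow hα hn).le.trans hβ'.le
  refine ⟨5 + 4 * β, by positivity, fun μ hg i hi f A hf hA h => ?_⟩
  have := hg.isLocallyFiniteMeasure
  have hβA : 0 ≤ β * A := by positivity
  cases i with
  | one =>
    exact ⟨(1 + 4 * β) * A, by linarith, by positivity,
      Bound1.abs hn hC₀ hη hα hβ' (hi (by simp)) hg hA hf h⟩
  | two => exact ⟨A, by linarith, hA, Bound2.abs hf h⟩
  | three => exact ⟨3 * A, by linarith, by positivity, Bound3.abs hη hα hA hf h⟩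
  | four => exact ⟨5 * A, by linarith, by positivity, Bound4.abs hα hf hA h⟩

/-! ### Local `L¹` control -/

/-- By compactness it suffices to argue near each point y. A point of the support is the centre of a
doubling cube of 𝒬_ex ∖ 𝒬, where the fourth condition bounds ∫|f|; any other point has a null
neighbourhood. The constant depends on the ball and on μ, which is harmless for definiteness and
completeness. -/
theorem exists_lintegral_closedBall_le {n C₀ η α β : ℝ} {i : Index} (hn : 0 < n) (hnd : n ≤ d)
    (hC₀ : 0 < C₀) (hη : 1 < η) (hα : 1 < α) (hβ : α ^ d < β) (hg : Growth μ n C₀)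
    (hi : i ≠ Index.two → η ≤ α) (x : Fin d → ℝ) (r : ℝ) :
    ∃ C : ℝ, 0 ≤ C ∧ ∀ (f : (Fin d → ℝ) → ℝ) (A : ℝ), LocallyIntegrable f μ → 0 ≤ A →
      Bound i μ n η α β f A →
      ∫⁻ z in Metric.closedBall x r, ‖f z‖ₑ ∂μ ≤ ENNReal.ofReal (C * A) := by
  have := hg.isLocallyFiniteMeasure
  have hβ' := rpow_lt_of_pow_lt hnd hα hβ
  obtain ⟨C₄, hC₄, h₄⟩ := exists_bound4_of_bound d n C₀ η α β hn hnd hC₀ hη hα hβ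
  obtain ⟨M, hM, h₅⟩ := exists_doubling_above n C₀ α β hn hC₀ hα hβ'
  refine (isCompact_closedBall x r).induction_on (p := fun S => ∃ C : ℝ, 0 ≤ C ∧
    ∀ (f : (Fin d → ℝ) → ℝ) (A : ℝ), LocallyIntegrable f μ → 0 ≤ A → Bound i μ n η α β f A →
      ∫⁻ z in S, ‖f z‖ₑ ∂μ ≤ ENNReal.ofReal (C * A)) ?_ ?_ ?_ ?_
  · exact ⟨0, le_rfl, fun f A _ _ _ => by simp⟩
  · rintro S S' hSS' ⟨C, hC, h⟩
    exact ⟨C, hC, fun f A hf hA hB => (lintegral_mono_set hSS').trans (h f A hf hA hB)⟩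
  · rintro S S' ⟨C, hC, h⟩ ⟨C', hC', h'⟩
    refine ⟨C + C', by positivity, fun f A hf hA hB => (lintegral_union_le _ _ _).trans ?_⟩
    rw [add_mul, ENNReal.ofReal_add (by positivity) (by positivity)]
    exact add_le_add (h f A hf hA hB) (h' f A hf hA hB)
  · intro y _
    by_cases hy : y ∈ μ.support
    · obtain ⟨T, hT, hT1, -, hTd, hTs⟩ := h₅ μ hg y hy 1 one_pos
      set P : Cube μ := ⟨y, T, hy, hT⟩ with hP
      refine ⟨P.toSet, mem_nhdsWithin_of_mem_nhds (Metric.closedBall_mem_nhds y (half_pos hT)),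
        C₄ * μ.real P.toSet, by positivity, fun f A hf hA hB => ?_⟩
      have h1 := (inv_mul_le_iff_le_mul_real P.measureReal_toSet_pos).1
        ((h₄ μ hg i hi f A hf hA hB).2.2 P hTd (hTs le_rfl) (not_le.2 hT1))
      rw [← ofReal_integral_norm_eq_lintegral_enorm (P.integrableOn hf)]
      refine ENNReal.ofReal_le_ofReal (h1.trans (le_of_eq (by ring)))
    · obtain ⟨U, hU, hU0⟩ := Measure.notMem_support_iff_exists.1 hy
      refine ⟨U, mem_nhdsWithin_of_mem_nhds hU, 0, le_rfl, fun f A _ _ _ => ?_⟩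
      rw [Measure.restrict_eq_zero.2 hU0]
      simp

/-! ### The norms -/

theorem normRbmo_nonneg (i : Index) (μ : Measure (Fin d → ℝ)) (n η α β : ℝ)
    (f : (Fin d → ℝ) → ℝ) : 0 ≤ normRbmo i μ n η α β f :=
  Real.sInf_nonneg fun _ h => h.1

theorem normRbmo_le {i : Index} {n η α β A : ℝ} {f : (Fin d → ℝ) → ℝ} (hA : 0 ≤ A)
    (h : Bound i μ n η α β f A) : normRbmo i μ n η α β f ≤ A :=
  csInf_le ⟨0, fun _ h => h.1⟩ ⟨hA, h⟩

theorem MemRbmo.exists_lt {i : Index} {n η α β : ℝ} {f : (Fin d → ℝ) → ℝ}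
    (hf : MemRbmo i μ n η α β f) {ε : ℝ} (hε : 0 < ε) :
    ∃ A, 0 ≤ A ∧ Bound i μ n η α β f A ∧ A < normRbmo i μ n η α β f + ε := by
  obtain ⟨A, ⟨hA, hB⟩, hlt⟩ := exists_lt_of_csInf_lt
    (s := {C : ℝ | 0 ≤ C ∧ Bound i μ n η α β f C}) hf.2 (lt_add_of_pos_right _ hε)
  exact ⟨A, hA, hB, hlt⟩

theorem normRBMO_le {n η α β A : ℝ} {f : (Fin d → ℝ) → ℝ} (hA : 0 ≤ A)
    (h : BoundRBMO μ n η α β f A) : normRBMO μ n η α β f ≤ A :=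
  csInf_le ⟨0, fun _ h => h.1⟩ ⟨hA, h⟩

/-- If `x ≤ C * A` for all admissible constants `A`, then `x ≤ C * ‖f‖`. -/
theorem MemRbmo.le_mul_norm {i : Index} {n η α β C x : ℝ} {f : (Fin d → ℝ) → ℝ}
    (hf : MemRbmo i μ n η α β f) (hC : 0 ≤ C)
    (h : ∀ A, 0 ≤ A → Bound i μ n η α β f A → x ≤ C * A) :
    x ≤ C * normRbmo i μ n η α β f := by
  refine le_of_forall_pos_le_add fun ε hε => ?_
  -- Dividing by C + 1 allows for C = 0.
  obtain ⟨A, hA, hB, hlt⟩ := hf.exists_lt (ε := ε / (C + 1)) (by positivity)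
  have h1 : C * (ε / (C + 1)) ≤ ε := by
    rw [mul_div_assoc', div_le_iff₀ (by positivity)]
    linarith
  calc x ≤ C * A := h A hA hB
    _ ≤ C * (normRbmo i μ n η α β f + ε / (C + 1)) := by gcongr
    _ ≤ _ := by linarith

/-! ### Vector space structure, definiteness and completeness -/

section space

variable {n C₀ η α β : ℝ} {i : Index} {f g : (Fin d → ℝ) → ℝ}

theorem MemRbmo.add (hC₀ : 0 < C₀) (hη : 1 < η) (hα : 1 < α) (hgr : Growth μ n C₀)
    (hf : MemRbmo i μ n η α β f) (hg : MemRbmo i μ n η α β g) :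
    MemRbmo i μ n η α β (f + g) := by
  obtain ⟨A, hA, hfA⟩ := hf.2
  obtain ⟨B, hB, hgB⟩ := hg.2
  exact ⟨hf.1.add hg.1, A + B, by positivity, hfA.add hC₀ hη hα hgr hf.1 hg.1 hA hB hgB⟩

theorem MemRbmo.norm_add_le (hC₀ : 0 < C₀) (hη : 1 < η) (hα : 1 < α) (hgr : Growth μ n C₀)
    (hf : MemRbmo i μ n η α β f) (hg : MemRbmo i μ n η α β g) :
    normRbmo i μ n η α β (f + g) ≤ normRbmo i μ n η α β f + normRbmo i μ n η α β g := by
  refine le_of_forall_pos_le_add fun ε hε => ?_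
  obtain ⟨A, hA, hfA, hlt⟩ := hf.exists_lt (half_pos hε)
  obtain ⟨B, hB, hgB, hlt'⟩ := hg.exists_lt (half_pos hε)
  have := normRbmo_le (by positivity) (hfA.add hC₀ hη hα hgr hf.1 hg.1 hA hB hgB)
  linarith

theorem MemRbmo.smul (hf : MemRbmo i μ n η α β f) (c : ℝ) : MemRbmo i μ n η α β (c • f) := by
  obtain ⟨A, hA, hfA⟩ := hf.2
  exact ⟨hf.1.smul c, |c| * A, by positivity, hfA.smul c⟩

theorem MemRbmo.norm_smul_le (hf : MemRbmo i μ n η α β f) (c : ℝ) :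
    normRbmo i μ n η α β (c • f) ≤ |c| * normRbmo i μ n η α β f :=
  hf.le_mul_norm (abs_nonneg c) fun _ hA hB => normRbmo_le (by positivity) (hB.smul c)

theorem MemRbmo.of_ae_eq_zero [IsLocallyFiniteMeasure μ] (hη : 1 < η) (hf : f =ᵐ[μ] 0) :
    MemRbmo i μ n η α β f ∧ normRbmo i μ n η α β f = 0 := by
  have hloc : LocallyIntegrable f μ := locallyIntegrable_zero.congr hf.symm
  have hB := bound_zero (n := n) (α := α) (β := β) hη hloc hf i
  exact ⟨⟨hloc, 0, le_rfl, hB⟩, le_antisymm (normRbmo_le le_rfl hB) (normRbmo_nonneg _ _ _ _ _ _ _)⟩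

theorem MemRbmo.const [IsLocallyFiniteMeasure μ] (hη : 1 < η) (c : ℝ) :
    MemRbmo i μ n η α β (fun _ => c) :=
  ⟨locallyIntegrable_const c, 2 * |c|, by positivity,
    bound_of_ae_le hη (locallyIntegrable_const c) (abs_nonneg c) (by simp) i⟩

theorem MemRbmo.ae_eq_zero (hn : 0 < n) (hnd : n ≤ d)
    (hC₀ : 0 < C₀) (hη : 1 < η) (hα : 1 < α) (hβ : α ^ d < β) (hg : Growth μ n C₀)
    (hi : i ≠ Index.two → η ≤ α) (hf : MemRbmo i μ n η α β f)
    (h0 : normRbmo i μ n η α β f = 0) : f =ᵐ[μ] 0 := by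
  have hball : ∀ N : ℕ, ∀ᵐ z ∂(μ.restrict (Metric.closedBall 0 N)), f z = 0 := by
    intro N
    obtain ⟨C, hC, h⟩ := exists_lintegral_closedBall_le hn hnd hC₀ hη hα hβ hg hi 0 N
    have hint := hf.1.integrableOn_isCompact (isCompact_closedBall (0 : Fin d → ℝ) N)
    have h1 : ∫ z in Metric.closedBall 0 (N : ℝ), ‖f z‖ ∂μ ≤ C * normRbmo i μ n η α β f := by
      refine hf.le_mul_norm hC fun A hA hB => ?_
      have h2 := h f A hf.1 hA hB
      rw [← ofReal_integral_norm_eq_lintegral_enorm hint] at h2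
      exact (ENNReal.ofReal_le_ofReal_iff (by positivity)).1 h2
    rw [h0, mul_zero] at h1
    have h2 := (integral_eq_zero_iff_of_nonneg (fun _ => norm_nonneg _) hint.norm).1
      (le_antisymm h1 (integral_nonneg fun _ => norm_nonneg _))
    filter_upwards [h2] with z hz
    simpa using hz
  have h3 := (ae_restrict_iUnion_iff (fun N : ℕ => Metric.closedBall (0 : Fin d → ℝ) N)
    (fun z => f z = 0)).2 hball
  rwa [Metric.iUnion_closedBall_nat, Measure.restrict_univ] at h3

variable (μ n η α β i) in
/-- The `i`-th `rbmo`-type space as a space of functions. -/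
def rbmoSubmodule (hC₀ : 0 < C₀) (hη : 1 < η) (hα : 1 < α) (hgr : Growth μ n C₀) :
    Submodule ℝ ((Fin d → ℝ) → ℝ) where
  carrier := {f | MemRbmo i μ n η α β f}
  add_mem' hf hg := MemRbmo.add hC₀ hη hα hgr hf hg
  zero_mem' :=
    have := hgr.isLocallyFiniteMeasure
    (MemRbmo.of_ae_eq_zero hη (Filter.EventuallyEq.refl _ _)).1
  smul_mem' c _ hf := MemRbmo.smul hf c

variable (μ n η α β i) in
/-- The seminorm of the `i`-th `rbmo`-type space. -/
def rbmoSeminorm (hC₀ : 0 < C₀) (hη : 1 < η) (hα : 1 < α) (hgr : Growth μ n C₀) :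
    Seminorm ℝ (rbmoSubmodule μ n η α β i hC₀ hη hα hgr) :=
  Seminorm.ofSMulLE (fun f => normRbmo i μ n η α β f)
    (have := hgr.isLocallyFiniteMeasure
    (MemRbmo.of_ae_eq_zero hη (Filter.EventuallyEq.refl _ _)).2)
    (fun f g => MemRbmo.norm_add_le hC₀ hη hα hgr f.2 g.2)
    (fun c f => MemRbmo.norm_smul_le f.2 c)

theorem rbmoSeminorm_apply (hC₀ : 0 < C₀) (hη : 1 < η) (hα : 1 < α) (hgr : Growth μ n C₀)
    (f : rbmoSubmodule μ n η α β i hC₀ hη hα hgr) :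
    rbmoSeminorm μ n η α β i hC₀ hη hα hgr f = normRbmo i μ n η α β f := rfl

/-- Admissible constants A k within 2^(-k) of the norms are summable, and the tails of ∑ A k are
admissible for the tails of the series of functions. -/
theorem seriesComplete_rbmoSeminorm (hn : 0 < n) (hnd : n ≤ d) (hC₀ : 0 < C₀) (hη : 1 < η)
    (hα : 1 < α) (hβ : α ^ d < β) (hgr : Growth μ n C₀) (hi : i ≠ Index.two → η ≤ α) :
    SeriesComplete (rbmoSeminorm μ n η α β i hC₀ hη hα hgr) := by
  intro g hg
  have := hgr.isLocallyFiniteMeasure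
  have hmem : ∀ k, MemRbmo i μ n η α β (g k) := fun k => (g k).2
  choose A hA hB hlt using fun k => (hmem k).exists_lt (ε := (1 / 2) ^ k) (by positivity)
  have hAs : Summable A := Summable.of_nonneg_of_le hA (fun k => (hlt k).le)
    (hg.add (summable_geometric_of_lt_one (by norm_num) (by norm_num)))
  have hloc : LocSum μ (fun k => (g k : (Fin d → ℝ) → ℝ))
      (fun z => ∑' k, (g k : (Fin d → ℝ) → ℝ) z) := by
    refine exists_locSum (fun k => (hmem k).1) fun x r => ?_
    obtain ⟨C, hC, h⟩ := exists_lintegral_closedBall_le hn hnd hC₀ hη hα hβ hgr hi x r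
    refine Summable.of_nonneg_of_le (fun k => integral_nonneg fun _ => abs_nonneg _)
      (fun k => ?_) (hAs.mul_left C)
    have h2 := h (g k) (A k) (hmem k).1 (hA k) (hB k)
    rw [← ofReal_integral_norm_eq_lintegral_enorm
      ((hmem k).1.integrableOn_isCompact (isCompact_closedBall x r))] at h2
    have := hA k
    exact (ENNReal.ofReal_le_ofReal_iff (by positivity)).1 h2
  have hf : MemRbmo i μ n η α β (fun z => ∑' k, (g k : (Fin d → ℝ) → ℝ) z) :=
    ⟨hloc.locallyIntegrable_sum, ∑' k, A k, tsum_nonneg hA,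
      hloc.bound hC₀ hη hα hgr hAs.hasSum hA hB⟩
  refine ⟨⟨_, hf⟩, squeeze_zero (fun N => apply_nonneg _ _) (fun N => ?_) (tendsto_sum_nat_add A)⟩
  rw [rbmoSeminorm_apply]
  refine normRbmo_le (tsum_nonneg fun k => hA _) ?_
  have h1 := (hloc.tail N).bound hC₀ hη hα hgr ((summable_nat_add_iff N).2 hAs).hasSum
    (fun k => hA _) (fun k => hB _)
  simpa using h1

theorem isBanachModulo_rbmo (hn : 0 < n) (hnd : n ≤ d) (hC₀ : 0 < C₀) (hη : 1 < η)
    (hα : 1 < α) (hβ : α ^ d < β) (hgr : Growth μ n C₀) (hi : i ≠ Index.two → η ≤ α) :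
    IsBanachModulo (MemRbmo i μ n η α β) (normRbmo i μ n η α β) (fun f => f =ᵐ[μ] 0) := by
  have := hgr.isLocallyFiniteMeasure
  exact isBanachModulo_of_seminorm (rbmoSubmodule μ n η α β i hC₀ hη hα hgr) (fun _ => Iff.rfl)
    (rbmoSeminorm μ n η α β i hC₀ hη hα hgr) (fun _ => rfl)
    (fun f => ⟨fun h => MemRbmo.ae_eq_zero hn hnd hC₀ hη hα hβ hgr hi f.2 h,
      fun h => (MemRbmo.of_ae_eq_zero hη h).2⟩)
    (seriesComplete_rbmoSeminorm hn hnd hC₀ hη hα hβ hgr hi)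

theorem isBanachModulo_rbmo_quotient (hn : 0 < n) (hnd : n ≤ d) (hC₀ : 0 < C₀) (hη : 1 < η)
    (hα : 1 < α) (hβ : α ^ d < β) (hgr : Growth μ n C₀) (hi : i ≠ Index.two → η ≤ α) :
    IsBanachModulo (MemRbmo i μ n η α β) (quotNormRbmo i μ n η α β)
      (fun f => ∃ c : ℝ, f =ᵐ[μ] fun _ => c) := by
  have := hgr.isLocallyFiniteMeasure
  set e : rbmoSubmodule μ n η α β i hC₀ hη hα hgr := ⟨fun _ => 1, MemRbmo.const hη 1⟩ with he
  have hsub : ∀ (f : rbmoSubmodule μ n η α β i hC₀ hη hα hgr) (c : ℝ),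
      ((f - c • e : rbmoSubmodule μ n η α β i hC₀ hη hα hgr) : (Fin d → ℝ) → ℝ) =
        fun x => (f : (Fin d → ℝ) → ℝ) x - c := by
    intro f c
    ext x
    simp [he]
  refine isBanachModulo_of_seminorm (rbmoSubmodule μ n η α β i hC₀ hη hα hgr) (fun _ => Iff.rfl)
    (quotSeminorm (rbmoSeminorm μ n η α β i hC₀ hη hα hgr) e) (fun f => ?_) (fun f => ?_)
    ((seriesComplete_rbmoSeminorm hn hnd hC₀ hη hα hβ hgr hi).quotSeminorm e)
  · rw [quotSeminorm_apply]
    simp only [rbmoSeminorm_apply, hsub, quotNormRbmo]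
  · rw [quotSeminorm_eq_zero_iff]
    refine exists_congr fun c => ?_
    rw [rbmoSeminorm_apply, hsub]
    constructor
    · intro h
      have h1 := (f - c • e).2
      rw [hsub] at h1
      filter_upwards [MemRbmo.ae_eq_zero hn hnd hC₀ hη hα hβ hgr hi h1 h] with x hx
      exact sub_eq_zero.1 hx
    · intro h
      refine (MemRbmo.of_ae_eq_zero hη ?_).2
      filter_upwards [h] with x hx
      exact sub_eq_zero.2 hx

end space

end LocalBMO

end

/-! ### The proposition -/

open MeasureTheory LocalBMO in
theorem proposition4p4 (d : ℕ) (n C₀ η α β : ℝ) (hn : 0 < n) (hnd : n ≤ d) (hC₀ : 0 < C₀)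
    (hη : 1 < η) (hα : 1 < α) (hβ : α ^ d < β) :
    ∃ C : ℝ, 0 < C ∧ ∀ μ : Measure (Fin d → ℝ), Growth μ n C₀ →
      ∀ i : Index, (i ≠ Index.two → η ≤ α) →
        -- Banach space, functions being identified when they agree almost everywhere
        IsBanachModulo (MemRbmo i μ n η α β) (normRbmo i μ n η α β) (fun f => f =ᵐ[μ] 0) ∧
        -- Banach space modulo additive constants
        IsBanachModulo (MemRbmo i μ n η α β) (quotNormRbmo i μ n η α β)
          (fun f => ∃ c : ℝ, f =ᵐ[μ] fun _ => c) ∧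
        (∀ f : (Fin d → ℝ) → ℝ, MemLp f ⊤ μ →
          MemRbmo i μ n η α β f ∧ normRbmo i μ n η α β f ≤ C * (eLpNorm f ⊤ μ).toReal) ∧
        (∀ f : (Fin d → ℝ) → ℝ, MemRbmo i μ n η α β f →
          MemRBMO μ n η α β f ∧ normRBMO μ n η α β f ≤ C * normRbmo i μ n η α β f) ∧
        (∀ f : (Fin d → ℝ) → ℝ, MemRbmo i μ n η α β f →
          MemRbmo i μ n η α β (fun x => |f x|) ∧
          normRbmo i μ n η α β (fun x => |f x|) ≤ C * normRbmo i μ n η α β f) ∧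
        (∀ f g : (Fin d → ℝ) → ℝ, MemRbmo i μ n η α β f → MemRbmo i μ n η α β g →
          (MemRbmo i μ n η α β (fun x => min (f x) (g x)) ∧
            normRbmo i μ n η α β (fun x => min (f x) (g x)) ≤
              C * (normRbmo i μ n η α β f + normRbmo i μ n η α β g)) ∧
          (MemRbmo i μ n η α β (fun x => max (f x) (g x)) ∧
            normRbmo i μ n η α β (fun x => max (f x) (g x)) ≤
              C * (normRbmo i μ n η α β f + normRbmo i μ n η α β g))) := by
  obtain ⟨C₁, hC₁, h₁⟩ := exists_bound4_of_bound d n C₀ η α β hn hnd hC₀ hη hα hβ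
  obtain ⟨C₂, hC₂, h₂⟩ := exists_boundRBMO_of_bound4 d n C₀ η α β hn hnd hC₀ hη hα hβ
  obtain ⟨C₃, hC₃, h₃⟩ := exists_bound_abs d n C₀ η α β hn hnd hC₀ hη hα hβ
  have hC₂₁ : 0 ≤ C₂ * C₁ := by positivity
  -- The summands serve bounded functions, the embedding into RBMO (through the fourth condition),
  -- and absolute values.
  refine ⟨2 + C₂ * C₁ + C₃, by positivity, fun μ hg i hi => ?_⟩
  have := hg.isLocallyFiniteMeasure
  have habs : ∀ f : (Fin d → ℝ) → ℝ, MemRbmo i μ n η α β f →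
      MemRbmo i μ n η α β (fun x => |f x|) ∧
      normRbmo i μ n η α β (fun x => |f x|) ≤ C₃ * normRbmo i μ n η α β f := by
    intro f hf
    constructor
    · obtain ⟨A, hA, hB⟩ := hf.2
      obtain ⟨A', -, hA', hB'⟩ := h₃ μ hg i hi f A hf.1 hA hB
      exact ⟨hf.1.abs, A', hA', hB'⟩
    · refine hf.le_mul_norm hC₃ fun A hA hB => ?_
      obtain ⟨A', hle, hA', hB'⟩ := h₃ μ hg i hi f A hf.1 hA hB
      exact (normRbmo_le hA' hB').trans hle
  -- The function (f + g + s|f - g|)/2 is the maximum for s = 1 and the minimum for s = -1.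
  have hcomb : ∀ (f g : (Fin d → ℝ) → ℝ) (s : ℝ), |s| = 1 → MemRbmo i μ n η α β f →
      MemRbmo i μ n η α β g →
      MemRbmo i μ n η α β ((1 / 2 : ℝ) • (f + g + s • fun x => |(f + (-1 : ℝ) • g) x|)) ∧
      normRbmo i μ n η α β ((1 / 2 : ℝ) • (f + g + s • fun x => |(f + (-1 : ℝ) • g) x|)) ≤
        (2 + C₂ * C₁ + C₃) * (normRbmo i μ n η α β f + normRbmo i μ n η α β g) := by
    intro f g s hs hf hgm
    have m1 := hf.add hC₀ hη hα hg hgm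
    have m2 := hf.add hC₀ hη hα hg (hgm.smul (-1))
    have m3 := habs _ m2
    have m4 := m1.add hC₀ hη hα hg (m3.1.smul s)
    have n1 := hf.norm_add_le hC₀ hη hα hg hgm
    have n2 := hf.norm_add_le hC₀ hη hα hg (hgm.smul (-1))
    have n3 := hgm.norm_smul_le (-1)
    have n4 := m1.norm_add_le hC₀ hη hα hg (m3.1.smul s)
    have n5 := m3.1.norm_smul_le s
    have n6 := m4.norm_smul_le (1 / 2)
    refine ⟨m4.smul _, n6.trans ?_⟩
    rw [hs, one_mul] at n5
    rw [abs_neg, abs_one, one_mul] at n3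
    rw [abs_of_pos (by norm_num : (0 : ℝ) < 1 / 2)]
    have n7 := mul_le_mul_of_nonneg_left (n2.trans (add_le_add le_rfl n3)) hC₃
    have p1 := normRbmo_nonneg i μ n η α β f
    have p2 := normRbmo_nonneg i μ n η α β g
    have p3 : 0 ≤ C₂ * C₁ * (normRbmo i μ n η α β f + normRbmo i μ n η α β g) := by positivity
    have p4 : 0 ≤ C₃ * (normRbmo i μ n η α β f + normRbmo i μ n η α β g) := by positivity
    linarith [m3.2]
  refine ⟨isBanachModulo_rbmo hn hnd hC₀ hη hα hβ hg hi,
    isBanachModulo_rbmo_quotient hn hnd hC₀ hη hα hβ hg hi, fun f hf => ?_, fun f hf => ?_,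
    fun f hf => ?_, fun f g hf hgm => ⟨?_, ?_⟩⟩
  · obtain ⟨hloc, hB⟩ := bound_of_memLp_top (n := n) (α := α) (β := β) hη hf i
    refine ⟨⟨hloc, _, by positivity, hB⟩, (normRbmo_le (by positivity) hB).trans ?_⟩
    gcongr
    linarith
  · constructor
    · obtain ⟨A, hA, hB⟩ := hf.2
      exact ⟨hf.1, C₂ * (C₁ * A), by positivity,
        h₂ μ hg f (C₁ * A) hf.1 (by positivity) (h₁ μ hg i hi f A hf.1 hA hB)⟩
    · have h4 : normRBMO μ n η α β f ≤ C₂ * C₁ * normRbmo i μ n η α β f := by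
        refine hf.le_mul_norm hC₂₁ fun A hA hB => ?_
        have := normRBMO_le (by positivity)
          (h₂ μ hg f (C₁ * A) hf.1 (by positivity) (h₁ μ hg i hi f A hf.1 hA hB))
        linarith
      have := normRbmo_nonneg i μ n η α β f
      refine h4.trans ?_
      gcongr
      linarith
  · refine ⟨(habs f hf).1, (habs f hf).2.trans ?_⟩
    have := normRbmo_nonneg i μ n η α β f
    gcongr
    linarith
  · have h := hcomb f g (-1) (by simp) hf hgm
    have he : (fun x => min (f x) (g x)) =
        (1 / 2 : ℝ) • (f + g + (-1 : ℝ) • fun x => |(f + (-1 : ℝ) • g) x|) := by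
      ext x
      simp only [Pi.smul_apply, Pi.add_apply, smul_eq_mul]
      rw [show f x + -1 * g x = f x - g x by ring]
      rcases le_total (f x) (g x) with h1 | h1
      · rw [min_eq_left h1, abs_of_nonpos (by linarith)]; ring
      · rw [min_eq_right h1, abs_of_nonneg (by linarith)]; ring
    rw [he]
    exact h
  · have h := hcomb f g 1 (by simp) hf hgm
    have he : (fun x => max (f x) (g x)) =
        (1 / 2 : ℝ) • (f + g + (1 : ℝ) • fun x => |(f + (-1 : ℝ) • g) x|) := by
      ext x
      simp only [Pi.smul_apply, Pi.add_apply, smul_eq_mul]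
      rw [show f x + -1 * g x = f x - g x by ring]
      rcases le_total (f x) (g x) with h1 | h1
      · rw [max_eq_right h1, abs_of_nonpos (by linarith)]; ring
      · rw [max_eq_left h1, abs_of_nonneg (by linarith)]; ring
    rw [he]
    exact h
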